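/- Let $K=\mathbb R$ or $\mathbb C$, let $E,F$ be Hilbert spaces over $K$, let $\mathcal B\subset\mathbb R^p$ be compact and let $\mathcal B'\supset\mathcal B$ be open. Let $m\mapsto A_m$ be a map into the bounded linear operators from $E$ to $F$ which is of class $C^1$ on $\mathcal B'$, with $A_m$ compact for every $m\in\mathcal B$. Assume: (U1) for all $m,m'\in\mathcal B$ and $u,v\in E$, if $u\neq0$ and $A_mu=A_{m'}v$, then $m=m'$ and $u=v$; (U2) for all $m\in\mathcal B$ and $q\in\mathbb R^p$ with $|q|=1$, the linear map $E\times E\to F$, $(u,v)\mapsto(\partial_qA_m)u+A_mv$, is injective. For $m\in\mathcal B$ let $\lambda_1^2(m)>\lambda_2^2(m)>\dots$ be the distinct eigenvalues of $A_m^*A_m$, with the convention $\lambda_k^2(m)=0$ if there are fewer than $k$ of them. Fix an integer $N\ge1$. For $c\in\mathcal B$ put $\tau(c)=\tfrac12\left(\lambda_N^2(c)+\lambda_{N+1}^2(c)\right)$, and let $R=\max_{m\in\mathcal B}\|A_m^*A_m\|+1$. For $c,m\in\mathcal B$ such that the circle $|z|=\tau(c)$ does not meet the spectrum of $A_m^*A_m$,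 define $$P_{m}^{(c)}=\frac1{2\mathrm i\pi}\int_{|z|=R}(zI-A_m^*A_m)^{-1}\,dz-\frac1{2\mathrm i\pi}\int_{|z|=\tau(c)}(zI-A_m^*A_m)^{-1}\,dz$$ (for $K=\mathbb R$ the resolvents and integrals are taken in the complexification of $E$, and the resulting operator is restricted to $E$; an integral over a circle of radius $0$ is $0$). Call a finite family of parameters $m_i\in\mathcal B$ and closed sets $V_{m_i}\subset\mathbb R^p$, $i\in I$, admissible if the sets $V_{m_i}$ cover $\mathcal B$ and, for every $i\in I$ and $m\in\mathcal B\cap V_{m_i}$, the circle $|z|=\tau(m_i)$ does not meet the spectrum of $A_m^*A_m$. For such a family write $P_{m,i}=P_m^{(m_i)}$ for $m\in\mathcal B\cap V_{m_i}$. Then: 1. There is an admissible finite family in which every $V_{m_i}$ is a closed ball of positive radius centred at $m_i$. 2. For every admissible finite family there is a constant $C>0$ such that for all $i,j\in I$, all $m\in\mathcal B\cap V_{m_i}$ and $m'\in\mathcal B\cap V_{m_j}$, and all $u\in R(P_{m,i})$ and $v\in R(P_{m',j})$, $$\|A_mu-A_{m'}v\|\ \ge\ C\left(|m-m'|\,\|v\|+\|u-v\|\right).$$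 -/

import Mathlib

open Set Metric

noncomputable section

/-- The complex space `E ⊕ iE`, with the Hilbert norm, built on the underlying real space of the
`𝕜`-space `E`. -/
def Complexification (𝕜 : Type*) [RCLike 𝕜] (E : Type*) : Type _ :=
  WithLp 2 (E × E)

namespace Complexification

set_option linter.unusedSectionVars false

variable {𝕜 : Type*} [RCLike 𝕜] {E : Type*} [NormedAddCommGroup E]

instance : NormedAddCommGroup (Complexification 𝕜 E) :=
  inferInstanceAs (NormedAddCommGroup (WithLp 2 (E × E)))

instance [CompleteSpace E] : CompleteSpace (Complexification 𝕜 E) :=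
  inferInstanceAs (CompleteSpace (WithLp 2 (E × E)))

variable (𝕜) in
/-- The vector `x + i y`. -/
def mk (x y : E) : Complexification 𝕜 E := WithLp.toLp 2 (x, y)

/-- The real part `x` of `x + i y`. -/
def re (w : Complexification 𝕜 E) : E := WithLp.fst (p := 2) (α := E) (β := E) w

/-- The imaginary part `y` of `x + i y`. -/
def im (w : Complexification 𝕜 E) : E := WithLp.snd (p := 2) (α := E) (β := E) w

@[simp] theorem re_mk (x y : E) : (mk 𝕜 x y).re = x := rfl
@[simp] theorem im_mk (x y : E) : (mk 𝕜 x y).im = y := rfl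
@[simp] theorem re_add (v w : Complexification 𝕜 E) : (v + w).re = v.re + w.re := rfl
@[simp] theorem im_add (v w : Complexification 𝕜 E) : (v + w).im = v.im + w.im := rfl
@[simp] theorem re_zero : (0 : Complexification 𝕜 E).re = 0 := rfl
@[simp] theorem im_zero : (0 : Complexification 𝕜 E).im = 0 := rfl

@[ext] theorem ext {v w : Complexification 𝕜 E} (h1 : v.re = w.re) (h2 : v.im = w.im) : v = w :=
  congrArg (WithLp.toLp 2) (Prod.ext h1 h2)

theorem norm_sq_eq (w : Complexification 𝕜 E) : ‖w‖ ^ 2 = ‖w.re‖ ^ 2 + ‖w.im‖ ^ 2 :=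
  WithLp.prod_norm_sq_eq_of_L2 (α := E) (β := E) w

theorem continuous_re : Continuous (re : Complexification 𝕜 E → E) :=
  continuous_fst.comp (WithLp.prod_continuous_ofLp 2 E E)

theorem continuous_im : Continuous (im : Complexification 𝕜 E → E) :=
  continuous_snd.comp (WithLp.prod_continuous_ofLp 2 E E)

theorem continuous_mk : Continuous (fun p : E × E => mk 𝕜 p.1 p.2) :=
  WithLp.prod_continuous_toLp 2 E E

variable [InnerProductSpace 𝕜 E]

/-- `(a + i b) (x + i y) = (a x - b y) + i (a y + b x)`. -/
instance : SMul ℂ (Complexification 𝕜 E) :=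
  ⟨fun z w => mk 𝕜 ((z.re : 𝕜) • w.re - (z.im : 𝕜) • w.im)
    ((z.re : 𝕜) • w.im + (z.im : 𝕜) • w.re)⟩

@[simp] theorem re_smul (z : ℂ) (w : Complexification 𝕜 E) :
    (z • w).re = (z.re : 𝕜) • w.re - (z.im : 𝕜) • w.im := rfl

@[simp] theorem im_smul (z : ℂ) (w : Complexification 𝕜 E) :
    (z • w).im = (z.re : 𝕜) • w.im + (z.im : 𝕜) • w.re := rfl

instance : Module ℂ (Complexification 𝕜 E) where
  one_smul w := by ext <;> simp
  mul_smul a b w := by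
    ext <;> simp [add_smul, sub_smul, mul_smul, smul_add, smul_sub] <;> abel
  smul_zero a := by ext <;> simp
  smul_add a v w := by ext <;> simp <;> abel
  add_smul a b w := by ext <;> simp [add_smul] <;> abel
  zero_smul w := by ext <;> simp

theorem norm_smul_eq (z : ℂ) (w : Complexification 𝕜 E) : ‖z • w‖ = ‖z‖ * ‖w‖ := by
  rw [← sq_eq_sq₀ (norm_nonneg _) (by positivity), mul_pow, norm_sq_eq, norm_sq_eq, re_smul,
    im_smul, @norm_sub_sq 𝕜, @norm_add_sq 𝕜, ← Complex.normSq_eq_norm_sq, Complex.normSq_apply]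
  simp only [norm_smul, inner_smul_left, inner_smul_right, RCLike.conj_ofReal, mul_pow,
    RCLike.norm_ofReal, sq_abs, RCLike.re_ofReal_mul, inner_re_symm (𝕜 := 𝕜) w.re w.im]
  ring

instance : NormedSpace ℂ (Complexification 𝕜 E) where
  norm_smul_le z w := (norm_smul_eq z w).le

/-- The complexification `x + i y ↦ T x + i T y` of an operator, as a ring homomorphism. -/
def map : (E →L[𝕜] E) →+* (Complexification 𝕜 E →L[ℂ] Complexification 𝕜 E) where
  toFun T :=
    { toFun := fun w => mk 𝕜 (T w.re) (T w.im)
      map_add' := fun v w => by ext <;> simp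
      map_smul' := fun z w => by ext <;> simp
      cont := continuous_mk.comp
        ((T.continuous.comp continuous_re).prodMk (T.continuous.comp continuous_im)) }
  map_one' := by ext <;> simp
  map_mul' S T := by ext <;> simp
  map_zero' := by ext <;> simp
  map_add' S T := by ext <;> simp

@[simp] theorem re_map (T : E →L[𝕜] E) (w : Complexification 𝕜 E) : (map T w).re = T w.re := rfl
@[simp] theorem im_map (T : E →L[𝕜] E) (w : Complexification 𝕜 E) : (map T w).im = T w.im := rfl

end Complexification

section

open Complexification

variable {𝕜 : Type*} [RCLike 𝕜] {E : Type*} [NormedAddCommGroup E] [InnerProductSpace 𝕜 E]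
  [CompleteSpace E]

/-- `(2πi)⁻¹ ∮ (z - T)⁻¹ dz` over the circle `|z| = r`, an operator on the complexification. -/
def contourOperator (T : E →L[𝕜] E) (r : ℝ) :
    Complexification 𝕜 E →L[ℂ] Complexification 𝕜 E :=
  (2 * Real.pi * Complex.I : ℂ)⁻¹ • ∮ z in C(0, r), resolvent (map T) z

theorem commute_contourOperator {S T : E →L[𝕜] E} (h : Commute S T) (r : ℝ) :
    Commute (map S) (contourOperator T r) := by
  have hR : ∀ z : ℂ, Commute (map S) (resolvent (map T) z) := by
    intro z
    have h0 : Commute (map S) (algebraMap ℂ _ z - map T) :=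
      (show Commute (map S) _ from (Algebra.commutes z (map S)).symm).sub_right (h.map map)
    unfold resolvent
    by_cases hu : IsUnit (algebraMap ℂ (Complexification 𝕜 E →L[ℂ] Complexification 𝕜 E) z - map T)
    · obtain ⟨u, hu⟩ := hu
      rw [← hu] at h0 ⊢
      rw [Ring.inverse_unit]
      exact h0.units_inv_right
    · rw [Ring.inverse_non_unit _ hu]
      exact Commute.zero_right _
  refine Commute.smul_right ?_ _
  rw [circleIntegral]
  set f : ℝ → (Complexification 𝕜 E →L[ℂ] Complexification 𝕜 E) := fun θ =>
    deriv (circleMap 0 r) θ • resolvent (map T) (circleMap 0 r θ) with hf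
  have hfc : ∀ θ, map S * f θ = f θ * map S := fun θ => ((hR _).smul_right _).eq
  by_cases hi : IntervalIntegrable f MeasureTheory.volume 0 (2 * Real.pi)
  · have h1 := (ContinuousLinearMap.mul ℂ _ (map S)).intervalIntegral_comp_comm hi
    have h2 := ((ContinuousLinearMap.mul ℂ _).flip (map S)).intervalIntegral_comp_comm hi
    simp only [ContinuousLinearMap.mul_apply', ContinuousLinearMap.flip_apply] at h1 h2
    rw [Commute, SemiconjBy, ← h1, ← h2]
    simp only [hfc]
  · rw [intervalIntegral.integral_undef hi]
    exact Commute.zero_right _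

/-- The operator `(2πi)⁻¹ ∮_{|z| = r} (z - T)⁻¹ dz` on `E`: the resolvent and the integral are taken
on the complexification, and the result is restricted to `E`. -/
def rieszIntegral (T : E →L[𝕜] E) (r : ℝ) : E →L[𝕜] E where
  toFun x := (contourOperator T r (mk 𝕜 x 0)).re
  map_add' x y := by
    rw [← re_add, ← map_add]
    congr 2
    ext <;> simp
  map_smul' c x := by
    have h := commute_contourOperator (Commute.smul_left (Commute.one_left T) c) r
    have h2 := congrArg re (congrArg (fun Q => Q (mk 𝕜 x 0)) h.eq)
    simp only [mul_apply_eq_comp, re_map] at h2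
    have h3 : map (c • (1 : E →L[𝕜] E)) (mk 𝕜 x 0) = mk 𝕜 (c • x) 0 := by ext <;> simp
    rw [h3] at h2
    simpa using h2.symm
  cont := continuous_re.comp ((contourOperator T r).continuous.comp
    (continuous_mk.comp (continuous_id.prodMk continuous_const)))

/-- Over `ℂ` the operator `rieszIntegral T r` is the contour integral of the resolvent of `T`. -/
theorem rieszIntegral_eq_of_complex {E : Type*} [NormedAddCommGroup E] [InnerProductSpace ℂ E]
    [CompleteSpace E] (T : E →L[ℂ] E) {r : ℝ} (hr : 0 ≤ r)
    (hT : sphere (0 : ℂ) r ⊆ resolventSet ℂ T) :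
    rieszIntegral T r = (2 * Real.pi * Complex.I : ℂ)⁻¹ • ∮ z in C(0, r), resolvent T z := by
  have hmem : ∀ θ, circleMap 0 r θ ∈ sphere (0 : ℂ) r := circleMap_mem_sphere 0 hr
  have hinv : ∀ z ∈ sphere (0 : ℂ) r, ∀ x,
      z • resolvent T z x - T (resolvent T z x) = x ∧ resolvent T z (z • x - T x) = x := by
    intro z hz x
    have hu := spectrum.mem_resolventSet_iff.1 (hT hz)
    constructor
    · have := congrArg (fun Q => Q x) (Ring.mul_inverse_cancel _ hu)
      simpa [resolvent, Algebra.algebraMap_eq_smul_one] using this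
    · have := congrArg (fun Q => Q x) (Ring.inverse_mul_cancel _ hu)
      simpa [resolvent, Algebra.algebraMap_eq_smul_one] using this
  have hI : Complex.I * Complex.I = -1 := Complex.I_mul_I
  have hz1 : ∀ (z : ℂ) (w : Complexification ℂ E),
      (z • w).re + Complex.I • (z • w).im = z • (w.re + Complex.I • w.im) := by
    intro z w
    simp only [re_smul, im_smul]
    nth_rewrite 5 [← Complex.re_add_im z]
    simp only [Complex.coe_algebraMap]
    match_scalars
    · ring
    · linear_combination (-z.im : ℂ) * hI
  have hz2 : ∀ (z : ℂ) (w : Complexification ℂ E),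
      (z • w).re - Complex.I • (z • w).im = (starRingEnd ℂ z) • (w.re - Complex.I • w.im) := by
    intro z w
    simp only [re_smul, im_smul]
    have : starRingEnd ℂ z = z.re - z.im * Complex.I := by
      apply Complex.ext <;> simp
    rw [this]
    match_scalars
    · simp; ring
    · simp; linear_combination (-z.im : ℂ) * hI
  let L : E → E → Complexification ℂ E := fun a b =>
    mk ℂ ((1 / 2 : ℂ) • (a + b)) ((-Complex.I / 2 : ℂ) • (a - b))
  have hLsmul : ∀ (z : ℂ) (a b : E), z • L a b = L (z • a) (starRingEnd ℂ z • b) := by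
    intro z a b
    have h1 : starRingEnd ℂ z = z.re - z.im * Complex.I := by
      apply Complex.ext <;> simp
    have h2 : z • a = ((z.re : ℂ) + z.im * Complex.I) • a := by rw [Complex.re_add_im]
    rw [h1, h2]
    ext
    · simp only [L, re_smul, re_mk, im_mk]
      match_scalars
      · simp; linear_combination (1 / 2 : ℂ) * Complex.re_add_im z
      · simp; ring
    · simp only [L, im_smul, re_mk, im_mk]
      match_scalars
      · simp
        linear_combination (z.im / 2 : ℂ) * hI - (Complex.I / 2) * Complex.re_add_im z
      · simp
        linear_combination (z.im / 2 : ℂ) * hI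
  have hLadd : ∀ a b a' b' : E, L (a + a') (b + b') = L a b + L a' b' := by
    intro a b a' b'
    ext <;> simp only [L, re_add, im_add, re_mk, im_mk] <;> module
  have hLre : ∀ a b : E, (L a b).re + Complex.I • (L a b).im = a := by
    intro a b
    simp only [L, re_mk, im_mk]
    match_scalars
    · linear_combination (-1 / 2 : ℂ) * hI
    · linear_combination (1 / 2 : ℂ) * hI
  have hLim : ∀ a b : E, (L a b).re - Complex.I • (L a b).im = b := by
    intro a b
    simp only [L, re_mk, im_mk]
    match_scalars
    · linear_combination (1 / 2 : ℂ) * hI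
    · linear_combination (-1 / 2 : ℂ) * hI
  have hLw : ∀ w : Complexification ℂ E,
      L (w.re + Complex.I • w.im) (w.re - Complex.I • w.im) = w := by
    intro w
    ext <;> simp only [L, re_mk, im_mk]
    · module
    · match_scalars
      · ring
      · linear_combination (-1 : ℂ) * hI
  have hLT : ∀ a b : E, map T (L a b) = L (T a) (T b) := by
    intro a b
    ext <;> simp [L]
  have hLsub : ∀ a b a' b' : E, L a b - L a' b' = L (a - a') (b - b') := by
    intro a b a' b'
    rw [sub_eq_iff_eq_add, ← hLadd, sub_add_cancel, sub_add_cancel]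
  have hLc : Continuous fun p : E × E => L p.1 p.2 :=
    continuous_mk.comp (by fun_prop : Continuous fun p : E × E =>
      ((1 / 2 : ℂ) • (p.1 + p.2), (-Complex.I / 2 : ℂ) • (p.1 - p.2)))
  let W : ℂ → (Complexification ℂ E →L[ℂ] Complexification ℂ E) := fun z =>
    { toFun := fun w => L (resolvent T z (w.re + Complex.I • w.im))
        (resolvent T (starRingEnd ℂ z) (w.re - Complex.I • w.im))
      map_add' := fun v w => by
        rw [← hLadd, ← map_add, ← map_add, re_add, im_add]
        congr 2 <;> module
      map_smul' := fun c w => by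
        rw [hz1, hz2, map_smul, map_smul, ← hLsmul]
        rfl
      cont := by
        have h1 := continuous_re (𝕜 := ℂ) (E := E)
        have h2 := continuous_im (𝕜 := ℂ) (E := E)
        exact hLc.comp (Continuous.prodMk (by fun_prop) (by fun_prop)) }
  have hstar : ∀ z ∈ sphere (0 : ℂ) r, starRingEnd ℂ z ∈ sphere (0 : ℂ) r := by
    intro z hz
    simpa using hz
  have hW : ∀ z ∈ sphere (0 : ℂ) r,
      z ∈ resolventSet ℂ (map T) ∧ resolvent (map T) z = W z := by
    intro z hz
    have h1 : (algebraMap ℂ _ z - map T) * W z = 1 := by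
      refine ContinuousLinearMap.ext fun w => ?_
      have : z • W z w - map T (W z w) = w := by
        change z • L _ _ - map T (L _ _) = w
        rw [hLsmul, hLT, hLsub, (hinv z hz _).1, (hinv _ (hstar z hz) _).1, hLw]
      simpa [Algebra.algebraMap_eq_smul_one] using this
    have h2 : W z * (algebraMap ℂ _ z - map T) = 1 := by
      refine ContinuousLinearMap.ext fun w => ?_
      have : W z (z • w - map T w) = w := by
        nth_rewrite 1 2 [← hLw w]
        rw [hLsmul, hLT, hLsub]
        change L _ _ = w
        rw [hLre, hLim, (hinv z hz _).2, (hinv _ (hstar z hz) _).2, hLw]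
      simpa [Algebra.algebraMap_eq_smul_one] using this
    exact ⟨(⟨_, _, h1, h2⟩ : Units _).isUnit, Ring.inverse_unit (⟨_, _, h1, h2⟩ : Units _)⟩
  have hd : Continuous (deriv (circleMap 0 r)) := by
    have : deriv (circleMap 0 r) = fun θ => circleMap 0 r θ * Complex.I :=
      funext fun θ => deriv_circleMap 0 r θ
    rw [this]
    fun_prop
  have hcont : Continuous fun θ => resolvent T (circleMap 0 r θ) :=
    continuous_iff_continuousAt.2 fun θ =>
      (spectrum.hasDerivAt_resolvent_const_left (hT (hmem θ))).continuousAt.comp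
        (continuous_circleMap 0 r).continuousAt
  have hcont' : Continuous fun θ => resolvent (map T) (circleMap 0 r θ) :=
    continuous_iff_continuousAt.2 fun θ =>
      (spectrum.hasDerivAt_resolvent_const_left (hW _ (hmem θ)).1).continuousAt.comp
        (continuous_circleMap 0 r).continuousAt
  ext x
  let k : ℂ := (2 * Real.pi : ℂ)⁻¹
  let g : ℝ → E := fun θ => (k * circleMap 0 r θ) • resolvent T (circleMap 0 r θ) x
  have hkd : ∀ θ, (2 * Real.pi * Complex.I : ℂ)⁻¹ * deriv (circleMap 0 r) θ =
      k * circleMap 0 r θ := by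
    intro θ
    rw [deriv_circleMap, mul_inv]
    change k * Complex.I⁻¹ * (circleMap 0 r θ * Complex.I) = k * circleMap 0 r θ
    have := Complex.I_ne_zero
    field_simp
  have hg : Continuous g := by
    have := continuous_circleMap 0 r
    exact (continuous_const.mul this).smul (hcont.clm_apply continuous_const)
  have hRHS : ((2 * Real.pi * Complex.I : ℂ)⁻¹ • ∮ z in C(0, r), resolvent T z) x =
      ∫ θ in (0 : ℝ)..2 * Real.pi, g θ := by
    rw [circleIntegral, smul_apply, ContinuousLinearMap.intervalIntegral_apply
      (φ := fun θ => deriv (circleMap 0 r) θ • resolvent T (circleMap 0 r θ))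
      ((hd.smul hcont).intervalIntegrable _ _), ← intervalIntegral.integral_smul]
    refine intervalIntegral.integral_congr fun θ _ => ?_
    simp only [smul_apply, smul_smul, hkd, g]
  have hneg : ∀ θ : ℝ, starRingEnd ℂ (circleMap 0 r θ) = circleMap 0 r (-θ) := by
    intro θ
    simp [circleMap, ← Complex.exp_conj]
  have hV : ∀ θ, (2 * Real.pi * Complex.I : ℂ)⁻¹ •
      (deriv (circleMap 0 r) θ • resolvent (map T) (circleMap 0 r θ)) (mk ℂ x 0) =
      L (g θ) (g (-θ)) := by
    intro θ
    have hk : starRingEnd ℂ k = k := by simp [k, Complex.conj_ofNat]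
    rw [smul_apply, smul_smul, hkd, (hW _ (hmem θ)).2]
    change _ • L _ _ = _
    rw [hLsmul, map_mul, hk, hneg]
    simp [g]
  let reL : Complexification ℂ E →L[ℝ] E :=
    { toFun := re
      map_add' := re_add
      map_smul' := fun c w => by
        change ((c : ℂ) • w).re = (c : ℂ) • w.re
        rw [re_smul]
        simp
      cont := continuous_re }
  have hgper : Function.Periodic g (2 * Real.pi) := by
    intro θ
    simp only [g, periodic_circleMap 0 r θ]
  have hgneg : ∫ θ in (0 : ℝ)..2 * Real.pi, g (-θ) = ∫ θ in (0 : ℝ)..2 * Real.pi, g θ := by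
    rw [intervalIntegral.integral_comp_neg]
    have := hgper.intervalIntegral_add_eq (-(2 * Real.pi)) 0
    simpa using this
  have hLint : IntervalIntegrable (fun θ => L (g θ) (g (-θ))) MeasureTheory.volume
      0 (2 * Real.pi) :=
    (hLc.comp (hg.prodMk (hg.comp continuous_neg))).intervalIntegrable _ _
  rw [hRHS]
  change (contourOperator T r (mk ℂ x 0)).re = _
  rw [contourOperator, circleIntegral, smul_apply, ContinuousLinearMap.intervalIntegral_apply
      (φ := fun θ => deriv (circleMap 0 r) θ • resolvent (map T) (circleMap 0 r θ))
      ((hd.smul hcont').intervalIntegrable _ _), ← intervalIntegral.integral_smul]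
  simp only [hV]
  have hre : ∀ w : Complexification ℂ E, w.re = reL w := fun _ => rfl
  rw [hre, ← reL.intervalIntegral_comp_comm hLint]
  change ∫ θ in (0 : ℝ)..2 * Real.pi, (1 / 2 : ℂ) • (g θ + g (-θ)) = _
  have hadd : ∫ θ in (0 : ℝ)..2 * Real.pi, (g θ + g (-θ)) =
      (∫ θ in (0 : ℝ)..2 * Real.pi, g θ) + ∫ θ in (0 : ℝ)..2 * Real.pi, g (-θ) :=
    intervalIntegral.integral_add (hg.intervalIntegrable _ _)
      ((hg.comp continuous_neg).intervalIntegrable _ _)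
  rw [intervalIntegral.integral_smul, hadd, hgneg]
  module

end

section

variable {𝕜 : Type*} [RCLike 𝕜] {E : Type*} [NormedAddCommGroup E] [InnerProductSpace 𝕜 E]
  [CompleteSpace E] {F : Type*} [NormedAddCommGroup F] [InnerProductSpace 𝕜 F] [CompleteSpace F]
  {P : Type*}

/-- The `k`-th largest distinct real eigenvalue of `T` (`k ≥ 1`): the largest `μ` such that at least
`k` distinct eigenvalues are `≥ μ`. It is `0` if there are fewer than `k` distinct eigenvalues. -/
def distinctEigenvalue (T : E →L[𝕜] E) (k : ℕ) : ℝ :=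
  sSup {μ : ℝ | Module.End.HasEigenvalue (T : E →ₗ[𝕜] E) (μ : 𝕜) ∧
    (k : ℕ∞) ≤ {ν : ℝ | Module.End.HasEigenvalue (T : E →ₗ[𝕜] E) (ν : 𝕜) ∧ μ ≤ ν}.encard}

/-- The operator `Aₘ* Aₘ`. -/
def gram (A : P → E →L[𝕜] F) (m : P) : E →L[𝕜] E :=
  (A m).adjoint ∘L A m

/-- The radius `max_{m ∈ B} ‖Aₘ* Aₘ‖ + 1` of the outer circle. -/
def outerRadius (A : P → E →L[𝕜] F) (B : Set P) : ℝ :=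
  sSup ((fun m => ‖gram A m‖) '' B) + 1

/-- The radius `(λ_N²(c) + λ_{N+1}²(c)) / 2` of the inner circle with reference parameter `c`. -/
def innerRadius (A : P → E →L[𝕜] F) (N : ℕ) (c : P) : ℝ :=
  (distinctEigenvalue (gram A c) N + distinctEigenvalue (gram A c) (N + 1)) / 2

/-- The spectral projector of `Aₘ* Aₘ` with reference parameter `c`, as a difference of two
contour integrals of the resolvent of `Aₘ* Aₘ`. -/
def spectralProjector (A : P → E →L[𝕜] F) (B : Set P) (N : ℕ) (c m : P) : E →L[𝕜] E :=
  rieszIntegral (gram A m) (outerRadius A B) - rieszIntegral (gram A m) (innerRadius A N c)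

/-- Closed sets `V i` covering `B`, with reference parameters `c i ∈ B`, such that for every
`m ∈ B ∩ V i` the inner circle attached to `c i` does not meet the spectrum of `Aₘ* Aₘ`, that is,
the contour integral defining the projector with reference parameter `c i` makes sense at `m`. -/
structure IsSpectralCover [TopologicalSpace P] (A : P → E →L[𝕜] F) (B : Set P) (N : ℕ)
    {ι : Type*} (c : ι → P) (V : ι → Set P) : Prop where
  mem (i : ι) : c i ∈ B
  isClosed (i : ι) : IsClosed (V i)
  cover : B ⊆ ⋃ i, V i
  circle_subset (i : ι) (m : P) (hm : m ∈ B ∩ V i) :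
    sphere (0 : ℂ) (innerRadius A N (c i)) ⊆ resolventSet ℂ (Complexification.map (gram A m))

end

end

/-! ### Calculus on the eigenvectors of a compact positive operator. -/

section CompactPositive

open Module.End

variable {𝕜 : Type*} [RCLike 𝕜] {E : Type*} [NormedAddCommGroup E] [InnerProductSpace 𝕜 E]
  [CompleteSpace E] {T : E →L[𝕜] E}

/-! Everything about the projectors is checked on eigenvectors, which span a dense subspace since
`gram A m` is compact and positive. On an eigenvector the resolvent is a scalar, so by Cauchy's
formula `spectralProjector` keeps the eigenvalues above the inner radius and kills those below it
(`isUpperSpectralProjector_spectralProjector`).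

Cover: the midpoint τ(c) is not an eigenvalue of `gram A c`; when τ(c) = 0 this uses injectivity of
`A c`, a consequence of (U1). So `gram A c - τ(c)` is bounded below, and this persists near `c`. For
a positive operator such a bound at the point τ already puts the whole circle in the resolvent set
(`sphere_subset_resolventSet`). Compactness of `B` then gives a finite cover.

Lower bound: by homogeneity let ‖u‖ + ‖v‖ = 1, and suppose that it fails along a sequence.
Compactness of `gram A m₀`, a spectral gap that persists nearby and the Davis–Kahan estimate make u
and v converge (`exists_tendsto_of_mem_range`). By (U1) the limits agree: m₀ = m₀', u₀ = v₀ ≠ 0. Now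
divide by d = ‖m - m'‖ + ‖u - v‖. With h = lim (m - m')/d and w = (u - v)/d, differentiability gives
A w → -(∂ₕA) u₀.

If h ≠ 0, this limit lies in the range of `A m₀`, because the image of a closed ball of a Hilbert
space is closed; this contradicts (U2). If h = 0, then A w → 0, and only the part of w below the gap
could survive. That part comes from v alone, and Davis–Kahan bounds it by ‖T - T'‖/d, which tends to
0. Hence w → 0, although ‖(m - m')/d‖ + ‖w‖ = 1. -/

theorem dense_iSup_eigenspace (hT : IsCompactOperator T) (hs : T.IsPositive) :
    Dense ((⨆ μ, eigenspace (T : Module.End 𝕜 E) μ : Submodule 𝕜 E) : Set E) :=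
  Submodule.dense_iff_topologicalClosure_eq_top.2 (Submodule.topologicalClosure_eq_top_iff.2
    (ContinuousLinearMap.orthogonalComplement_iSup_eigenspaces_eq_bot hT hs.isSymmetric))

omit [CompleteSpace E] in
/-- A nonzero vector in an eigenspace of a positive operator belongs to a nonnegative real
eigenvalue. -/
theorem exists_eigenvalue_eq_ofReal (hs : T.IsPositive) {μ : 𝕜} {x : E} (hx : x ≠ 0)
    (h : T x = μ • x) : ∃ ν : ℝ, 0 ≤ ν ∧ μ = (ν : 𝕜) := by
  have hμ : HasEigenvalue (T : Module.End 𝕜 E) μ :=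
    hasEigenvalue_of_hasEigenvector ⟨mem_eigenspace_iff.2 h, hx⟩
  have hre : μ = (RCLike.re μ : 𝕜) :=
    (RCLike.conj_eq_iff_re.1 (hs.isSymmetric.conj_eigenvalue_eq_self hμ)).symm
  refine ⟨RCLike.re μ, ?_, hre⟩
  have h1 := hs.re_inner_nonneg_left x
  rw [h, hre, inner_smul_left, RCLike.conj_ofReal, RCLike.re_ofReal_mul,
    inner_self_eq_norm_sq] at h1
  have : 0 < ‖x‖ ^ 2 := by positivity
  exact nonneg_of_mul_nonneg_left h1 this

/-- For operators preserving the eigenspaces of a compact positive operator, a norm comparison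
on eigenvectors extends to the whole space. -/
theorem norm_le_norm_of_eigenvectors (hT : IsCompactOperator T) (hs : T.IsPositive)
    {G H : E →L[𝕜] E}
    (hGH : ∀ (μ : ℝ) (x : E), 0 ≤ μ → x ≠ 0 → T x = (μ : 𝕜) • x →
      T (G x) = (μ : 𝕜) • G x ∧ T (H x) = (μ : 𝕜) • H x ∧ ‖G x‖ ≤ ‖H x‖) (x : E) :
    ‖G x‖ ≤ ‖H x‖ := by
  have key : ∀ (μ : 𝕜) (x : E), T x = μ • x →
      T (G x) = μ • G x ∧ T (H x) = μ • H x ∧ ‖G x‖ ≤ ‖H x‖ := by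
    intro μ x h
    by_cases hx : x = 0
    · simp [hx]
    · obtain ⟨ν, hν, rfl⟩ := exists_eigenvalue_eq_ofReal hs hx h
      exact hGH ν x hν hx h
  refine (dense_iSup_eigenspace hT hs).induction (P := fun x => ‖G x‖ ≤ ‖H x‖) ?_
    (isClosed_le (by fun_prop) (by fun_prop)) x
  intro x hx
  obtain ⟨f, hf, rfl⟩ := (Submodule.mem_iSup_iff_exists_finsupp _ _).1 hx
  have hf' : ∀ μ, T (f μ) = μ • f μ := fun μ => mem_eigenspace_iff.1 (hf μ)
  have hO := hs.isSymmetric.orthogonalFamily_eigenspaces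
  -- Pythagoras: `K` keeps each component in its own eigenspace, so the images stay orthogonal.
  have e : ∀ K : E →L[𝕜] E, (∀ μ, T (K (f μ)) = μ • K (f μ)) →
      ‖K (f.sum fun _ y => y)‖ ^ 2 = ∑ μ ∈ f.support, ‖K (f μ)‖ ^ 2 := by
    intro K hK
    have := hO.norm_sum (fun μ => (⟨K (f μ), mem_eigenspace_iff.2 (hK μ)⟩ :
      eigenspace (T : Module.End 𝕜 E) μ)) f.support
    simpa [Finsupp.sum, map_sum] using this
  refine (sq_le_sq₀ (norm_nonneg _) (norm_nonneg _)).1 ?_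
  rw [e G fun μ => (key μ _ (hf' μ)).1, e H fun μ => (key μ _ (hf' μ)).2.1]
  exact Finset.sum_le_sum fun μ _ => by
    have := (key μ _ (hf' μ)).2.2
    gcongr

/-- Operators agreeing on the eigenvectors of a compact positive operator are equal. -/
theorem eq_of_eqOn_eigenvectors (hT : IsCompactOperator T) (hs : T.IsPositive)
    {G H : E →L[𝕜] E}
    (hGH : ∀ (μ : ℝ) (x : E), 0 ≤ μ → x ≠ 0 → T x = (μ : 𝕜) • x → G x = H x) : G = H := by
  ext x
  have h := norm_le_norm_of_eigenvectors hT hs (G := G - H) (H := 0) (fun μ x hμ hx h => by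
    simp [hGH μ x hμ hx h]) x
  simpa [sub_eq_zero] using h

/-- `P` is the identity on the eigenvectors of `T` with eigenvalue above `τ` and vanishes on those
with eigenvalue below `τ`, and `τ` is not an eigenvalue of `T`. -/
structure IsUpperSpectralProjector (T P : E →L[𝕜] E) (τ : ℝ) : Prop where
  apply_of_gt (μ : ℝ) (x : E) (hμ : τ < μ) (hx : T x = (μ : 𝕜) • x) : P x = x
  apply_of_lt (μ : ℝ) (x : E) (hμ0 : 0 ≤ μ) (hμ : μ < τ) (hx : T x = (μ : 𝕜) • x) : P x = 0
  ne (μ : ℝ) (x : E) (hx0 : x ≠ 0) (hx : T x = (μ : 𝕜) • x) : μ ≠ τ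

/-- No eigenvalue of `T` lies strictly between `a` and `b`. -/
def EigenvalueGap (T : E →L[𝕜] E) (a b : ℝ) : Prop :=
  ∀ (μ : ℝ) (x : E), 0 ≤ μ → x ≠ 0 → T x = (μ : 𝕜) • x → μ ≤ a ∨ b ≤ μ

namespace IsUpperSpectralProjector

variable {P : E →L[𝕜] E} {τ a b : ℝ}

omit [CompleteSpace E] in
theorem apply_eq (hP : IsUpperSpectralProjector T P τ) {μ : ℝ} {x : E} (hμ : 0 ≤ μ) (hx : x ≠ 0)
    (h : T x = (μ : 𝕜) • x) : (μ < τ ∧ P x = 0) ∨ (τ < μ ∧ P x = x) := by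
  rcases lt_or_gt_of_ne (hP.ne μ x hx h) with hlt | hgt
  · exact Or.inl ⟨hlt, hP.apply_of_lt μ x hμ hlt h⟩
  · exact Or.inr ⟨hgt, hP.apply_of_gt μ x hgt h⟩

theorem mul_self (hT : IsCompactOperator T) (hs : T.IsPositive)
    (hP : IsUpperSpectralProjector T P τ) : P * P = P :=
  eq_of_eqOn_eigenvectors hT hs fun μ x hμ hx h => by
    rcases hP.apply_eq hμ hx h with ⟨-, h1⟩ | ⟨-, h1⟩ <;> simp [h1]

theorem commute (hT : IsCompactOperator T) (hs : T.IsPositive)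
    (hP : IsUpperSpectralProjector T P τ) : Commute P T :=
  eq_of_eqOn_eigenvectors hT hs fun μ x hμ hx h => by
    rcases hP.apply_eq hμ hx h with ⟨-, h1⟩ | ⟨-, h1⟩ <;> simp [h1, h]

theorem apply_of_mem_range (hT : IsCompactOperator T) (hs : T.IsPositive)
    (hP : IsUpperSpectralProjector T P τ) {x : E} (hx : x ∈ range P) : P x = x := by
  obtain ⟨y, rfl⟩ := hx
  exact congrArg (fun Q => Q y) (hP.mul_self hT hs)

theorem norm_apply_le (hT : IsCompactOperator T) (hs : T.IsPositive)
    (hP : IsUpperSpectralProjector T P τ) (x : E) : ‖P x‖ ≤ ‖x‖ :=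
  norm_le_norm_of_eigenvectors hT hs (G := P) (H := 1) (fun μ x hμ hx h => by
    rcases hP.apply_eq hμ hx h with ⟨-, h1⟩ | ⟨-, h1⟩ <;> simp [h1, h]) x

theorem norm_sub_apply_le (hT : IsCompactOperator T) (hs : T.IsPositive)
    (hP : IsUpperSpectralProjector T P τ) (x : E) : ‖x - P x‖ ≤ ‖x‖ :=
  norm_le_norm_of_eigenvectors hT hs (G := 1 - P) (H := 1) (fun μ x hμ hx h => by
    rcases hP.apply_eq hμ hx h with ⟨-, h1⟩ | ⟨-, h1⟩ <;> simp [h1, h]) x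

/-- An eigenvalue above `τ ≥ a` cannot be at most `a`, so the gap pushes it up to at least `b`. The
next lemma is the counterpart below the gap. -/
theorem le_norm_apply (hT : IsCompactOperator T) (hs : T.IsPositive)
    (hP : IsUpperSpectralProjector T P τ) (hgap : EigenvalueGap T a b) (hb : 0 ≤ b)
    (haτ : a ≤ τ) (x : E) : b * ‖P x‖ ≤ ‖T (P x)‖ := by
  have := norm_le_norm_of_eigenvectors hT hs (G := (b : 𝕜) • P) (H := T * P)
    (fun μ x hμ hx h => by
      rcases hP.apply_eq hμ hx h with ⟨-, h1⟩ | ⟨h2, h1⟩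
      · simp [h1]
      · have hb' : b ≤ μ := (hgap μ x hμ hx h).resolve_left (by linarith)
        simp only [smul_apply, mul_apply_eq_comp, h1, map_smul, h, norm_smul,
          RCLike.norm_ofReal, abs_of_nonneg hb, abs_of_nonneg hμ]
        exact ⟨smul_comm _ _ _, trivial, by gcongr⟩) x
  simpa [norm_smul, abs_of_nonneg hb] using this

theorem norm_apply_sub_le (hT : IsCompactOperator T) (hs : T.IsPositive)
    (hP : IsUpperSpectralProjector T P τ) (hgap : EigenvalueGap T a b) (ha : 0 ≤ a)
    (hτb : τ ≤ b) (x : E) : ‖T (x - P x)‖ ≤ a * ‖x - P x‖ := by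
  have := norm_le_norm_of_eigenvectors hT hs (G := T * (1 - P)) (H := (a : 𝕜) • (1 - P))
    (fun μ x hμ hx h => by
      rcases hP.apply_eq hμ hx h with ⟨h2, h1⟩ | ⟨h2, h1⟩
      · have ha' : μ ≤ a := (hgap μ x hμ hx h).resolve_right (by linarith)
        simp only [smul_apply, mul_apply_eq_comp, h1, map_smul, h, norm_smul, sub_zero,
          sub_apply, one_apply_eq_self, RCLike.norm_ofReal, abs_of_nonneg ha, abs_of_nonneg hμ]
        exact ⟨trivial, smul_comm _ _ _, by gcongr⟩
      · simp [h1]) x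
  simpa [norm_smul, abs_of_nonneg ha] using this

/-- By density it suffices to pair two eigenvectors. Distinct eigenvalues give orthogonal vectors;
for equal ones `P` acts on both by the same scalar 0 or 1. -/
theorem isSelfAdjoint (hT : IsCompactOperator T) (hs : T.IsPositive)
    (hP : IsUpperSpectralProjector T P τ) : IsSelfAdjoint P := by
  have hadj : ∀ (μ : ℝ) (y : E), 0 ≤ μ → y ≠ 0 → T y = (μ : 𝕜) • y → P.adjoint y = P y := by
    intro μ y hμ hy h
    refine ext_inner_left 𝕜 fun x => ?_
    rw [ContinuousLinearMap.adjoint_inner_right]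
    refine (dense_iSup_eigenspace hT hs).induction
      (P := fun x => inner 𝕜 (P x) y = inner 𝕜 x (P y)) (fun x hx => ?_)
      (isClosed_eq (by fun_prop) (by fun_prop)) x
    refine Submodule.iSup_induction _ (motive := fun x => inner 𝕜 (P x) y = inner 𝕜 x (P y)) hx
      (fun κ x hx => ?_) (by simp)
      (fun x₁ x₂ h₁ h₂ => by rw [map_add, inner_add_left, inner_add_left, h₁, h₂])
    have hx' : T x = κ • x := mem_eigenspace_iff.1 hx
    by_cases hx0 : x = 0
    · simp [hx0]
    obtain ⟨ν, hν, rfl⟩ := exists_eigenvalue_eq_ofReal hs hx0 hx'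
    by_cases hμν : ν = μ
    · subst hμν
      rcases hP.apply_eq hμ hy h with ⟨h2, h1⟩ | ⟨h2, h1⟩
      · rw [h1, hP.apply_of_lt _ _ hν h2 hx', inner_zero_left, inner_zero_right]
      · rw [h1, hP.apply_of_gt _ _ h2 hx']
    · have horth : inner 𝕜 x y = 0 :=
        hs.isSymmetric.orthogonalFamily_eigenspaces (i := (ν : 𝕜)) (j := (μ : 𝕜))
          (by exact_mod_cast hμν) ⟨x, hx⟩ ⟨y, mem_eigenspace_iff.2 h⟩
      rcases hP.apply_eq hν hx0 hx' with ⟨-, h1⟩ | ⟨-, h1⟩ <;>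
      rcases hP.apply_eq hμ hy h with ⟨-, h2⟩ | ⟨-, h2⟩ <;> simp [h1, h2, horth]
  exact eq_of_eqOn_eigenvectors hT hs hadj

end IsUpperSpectralProjector

/-- A spectral gap bounds `T - τ` from below. -/
theorem le_norm_sub_smul_of_eigenvalueGap (hT : IsCompactOperator T) (hs : T.IsPositive)
    {τ δ : ℝ} (hδ : 0 ≤ δ) (hgap : EigenvalueGap T (τ - δ) (τ + δ)) (x : E) :
    δ * ‖x‖ ≤ ‖T x - (τ : 𝕜) • x‖ := by
  have := norm_le_norm_of_eigenvectors hT hs (G := (δ : 𝕜) • (1 : E →L[𝕜] E))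
    (H := T - (τ : 𝕜) • (1 : E →L[𝕜] E)) (fun μ x hμ hx h => by
      have h1 : T x - (τ : 𝕜) • x = ((μ - τ : ℝ) : 𝕜) • x := by
        rw [h, RCLike.ofReal_sub, sub_smul]
      have h2 : δ ≤ |μ - τ| := by
        rcases hgap μ x hμ hx h with h3 | h3
        · rw [le_abs]; right; linarith
        · rw [le_abs]; left; linarith
      simp only [smul_apply, sub_apply, one_apply_eq_self]
      rw [h1, map_smul, map_smul, h, norm_smul, norm_smul, RCLike.norm_ofReal, RCLike.norm_ofReal,
        abs_of_nonneg hδ]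
      exact ⟨smul_comm _ _ _, smul_comm _ _ _, by gcongr⟩) x
  simpa [norm_smul, abs_of_nonneg hδ] using this

end CompactPositive

/-! ### Resolvents and contour integrals on the complexification. -/

section Riesz

open Complexification

variable {𝕜 : Type*} [RCLike 𝕜] {E : Type*} [NormedAddCommGroup E] [InnerProductSpace 𝕜 E]
  [CompleteSpace E] {T : E →L[𝕜] E}

omit [InnerProductSpace 𝕜 E] [CompleteSpace E] in
theorem Complexification.re_sub (v w : Complexification 𝕜 E) : (v - w).re = v.re - w.re := rfl

omit [InnerProductSpace 𝕜 E] [CompleteSpace E] in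
theorem Complexification.im_sub (v w : Complexification 𝕜 E) : (v - w).im = v.im - w.im := rfl

/-- If `T ≥ 0` and `T - r` is bounded below, the circle of radius `r` lies in the resolvent set. -/
theorem sphere_subset_resolventSet (hs : T.IsPositive) {r δ : ℝ} (hδ : 0 < δ)
    (h : ∀ x, δ * ‖x‖ ≤ ‖T x - (r : 𝕜) • x‖) :
    sphere (0 : ℂ) r ⊆ resolventSet ℂ (Complexification.map T) := by
  intro z hz
  have hzr : ‖z‖ = r := by simpa using hz
  have hre : z.re ≤ r := hzr ▸ Complex.re_le_norm z
  have hsq : z.re * z.re + z.im * z.im = r * r := by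
    rw [← Complex.normSq_apply, Complex.normSq_eq_norm_sq, hzr, sq]
  set D : E →L[𝕜] E := T - (r : 𝕜) • 1 with hD
  -- For |z| = r, (z - T)(z̄ - T) = T² - 2 Re(z) T + r² = (T - r)² + 2(r - Re z) T. The second term
  -- is nonnegative, so the product is coercive with constant δ².
  set S : E →L[𝕜] E := D * D + ((2 * (r - z.re) : ℝ) : 𝕜) • T with hS
  have hDs : ∀ x y, inner 𝕜 (D x) y = inner 𝕜 x (D y) := by
    intro x y
    have := hs.isSymmetric x y
    simp only [ContinuousLinearMap.coe_coe] at this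
    simp [hD, inner_sub_left, inner_sub_right, inner_smul_left, inner_smul_right, this]
  have hSu : IsUnit S := by
    refine ContinuousLinearMap.isUnit_of_forall_le_norm_inner_map S
      (c := ⟨δ ^ 2, by positivity⟩) (by exact_mod_cast pow_pos hδ 2) fun x => ?_
    refine le_trans ?_ (RCLike.re_le_norm _)
    have h1 : inner 𝕜 (S x) x = inner 𝕜 (D x) (D x) +
        ((2 * (r - z.re) : ℝ) : 𝕜) * inner 𝕜 (T x) x := by
      rw [← hDs]
      simp [hS, inner_add_left, inner_smul_left]
    rw [h1, map_add, RCLike.re_ofReal_mul, inner_self_eq_norm_sq]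
    have h2 := h x
    have h3 : ‖D x‖ = ‖T x - (r : 𝕜) • x‖ := by simp [hD]
    have h4 := hs.re_inner_nonneg_left x
    have h5 : (δ * ‖x‖) ^ 2 ≤ ‖D x‖ ^ 2 := by rw [h3]; gcongr
    have h6 : 0 ≤ 2 * (r - z.re) * RCLike.re (inner 𝕜 (T x) x) :=
      mul_nonneg (by linarith) h4
    change ‖x‖ ^ 2 * δ ^ 2 ≤ _
    nlinarith
  have hfac : ∀ w : ℂ, w.re = z.re → w.im * w.im = z.im * z.im →
      (algebraMap ℂ (Complexification 𝕜 E →L[ℂ] Complexification 𝕜 E) w - map T) *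
      (algebraMap ℂ _ (starRingEnd ℂ w) - map T) = map S := by
    intro w hw1 hw2
    have hw : w.im * w.im = r * r - z.re * z.re := by rw [hw2]; linarith
    have hw' : ((w.im : ℝ) : 𝕜) * w.im = (r : 𝕜) * r - z.re * z.re := by exact_mod_cast hw
    have hSx : ∀ x, S x = T (T x) - (2 * z.re : 𝕜) • T x + (r * r : 𝕜) • x := by
      intro x
      simp only [hS, hD, sub_apply, smul_apply, mul_apply_eq_comp, one_apply_eq_self, map_sub,
        _root_.map_smul, add_apply, RCLike.ofReal_mul, RCLike.ofReal_ofNat]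
      module
    ext v <;>
      simp only [hSx, Algebra.algebraMap_eq_smul_one (R := ℂ), mul_apply_eq_comp, sub_apply,
        smul_apply, one_apply_eq_self, re_sub, im_sub, re_smul, im_smul, re_map, im_map, hw1,
        Complex.conj_re, Complex.conj_im, map_sub, _root_.map_smul, RCLike.ofReal_neg] <;>
      match_scalars <;> first | ring1 | linear_combination hw'
  have h1 := hfac z rfl rfl
  have h2 := hfac (starRingEnd ℂ z) (by simp) (by simp)
  rw [starRingEnd_self_apply] at h2
  have hu : IsUnit (map S) := hSu.map map
  rw [spectrum.mem_resolventSet_iff]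
  have hcomm : Commute (algebraMap ℂ (Complexification 𝕜 E →L[ℂ] Complexification 𝕜 E) z - map T)
      (algebraMap ℂ _ (starRingEnd ℂ z) - map T) := by rw [Commute, SemiconjBy, h1, h2]
  exact (hcomm.isUnit_mul_iff.1 (h1 ▸ hu)).1

omit [CompleteSpace E] in
theorem map_apply_mk_of_eigenvector {μ : ℝ} {x : E} (hx : T x = (μ : 𝕜) • x) :
    map T (mk 𝕜 x 0) = (μ : ℂ) • mk 𝕜 x 0 := by
  ext <;> simp [hx, re_smul, im_smul, -Complex.coe_smul]

omit [CompleteSpace E] in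
/-- Points of the spectrum on the real axis are detected by vectors of `E`. -/
theorem exists_le_norm_sub_smul {r : ℝ} (h : (r : ℂ) ∈ resolventSet ℂ (Complexification.map T)) :
    ∃ δ > 0, ∀ x, δ * ‖x‖ ≤ ‖T x - (r : 𝕜) • x‖ := by
  obtain ⟨u, hu⟩ := spectrum.mem_resolventSet_iff.1 h
  set W : Complexification 𝕜 E →L[ℂ] Complexification 𝕜 E := ↑u⁻¹
  refine ⟨(‖W‖ + 1)⁻¹, by positivity, fun x => ?_⟩
  rw [inv_mul_le_iff₀ (by positivity)]
  have h1 : W (u.1 (mk 𝕜 x 0)) = mk 𝕜 x 0 := congrArg (fun Q => Q (mk 𝕜 x 0)) u.inv_mul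
  have h2 : u.1 (mk 𝕜 x 0) = mk 𝕜 ((r : 𝕜) • x - T x) 0 := by
    rw [hu]
    ext
    · simp [Algebra.algebraMap_eq_smul_one, re_sub, -Complex.coe_smul, -Complex.coe_algebraMap]
    · simp [Algebra.algebraMap_eq_smul_one, im_sub, -Complex.coe_smul, -Complex.coe_algebraMap]
  have hn : ∀ y : E, ‖mk 𝕜 y 0‖ = ‖y‖ := by
    intro y
    rw [← sq_eq_sq₀ (norm_nonneg _) (norm_nonneg _), norm_sq_eq]
    simp
  have h3 := W.le_opNorm (u.1 (mk 𝕜 x 0))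
  rw [h1, h2, hn, hn, norm_sub_rev] at h3
  have := norm_nonneg (T x - (r : 𝕜) • x)
  nlinarith

/-- The resolvent at z multiplies the eigenvector by 1/(z - μ), and Cauchy's formula evaluates the
integral. The case `r = 0` fits: no |μ| is below 0 and the integral vanishes. -/
theorem rieszIntegral_apply_of_eigenvector {r μ : ℝ} (hr : 0 ≤ r)
    (hT : sphere (0 : ℂ) r ⊆ resolventSet ℂ (Complexification.map T))
    {x : E} (hx0 : x ≠ 0) (hx : T x = (μ : 𝕜) • x) :
    |μ| ≠ r ∧ rieszIntegral T r x = if |μ| < r then x else 0 := by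
  set w := mk 𝕜 x 0 with hw
  have hw0 : w ≠ 0 := fun h => hx0 (congrArg re h)
  have hTw := map_apply_mk_of_eigenvector (𝕜 := 𝕜) hx
  have hne : ∀ z ∈ sphere (0 : ℂ) r, z ≠ μ := by
    rintro z hz rfl
    obtain ⟨u, hu⟩ := spectrum.mem_resolventSet_iff.1 (hT hz)
    have h1 : (↑u⁻¹ : Complexification 𝕜 E →L[ℂ] Complexification 𝕜 E) (u.1 w) = w :=
      congrArg (fun Q => Q w) u.inv_mul
    rw [hu] at h1
    simp [Algebra.algebraMap_eq_smul_one, hTw, hw] at h1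
    exact hw0 h1.symm
  have hres : ∀ z ∈ sphere (0 : ℂ) r, resolvent (map T) z w = (z - μ)⁻¹ • w := by
    intro z hz
    obtain ⟨u, hu⟩ := spectrum.mem_resolventSet_iff.1 (hT hz)
    have h1 : (↑u⁻¹ : Complexification 𝕜 E →L[ℂ] Complexification 𝕜 E) (u.1 w) = w :=
      congrArg (fun Q => Q w) u.inv_mul
    have h2 : u.1 w = (z - μ) • w := by
      rw [hu, sub_smul, ← hTw]
      simp [Algebra.algebraMap_eq_smul_one, hw]
    rw [h2, map_smul] at h1
    rw [resolvent, ← hu, Ring.inverse_unit, eq_inv_smul_iff₀ (sub_ne_zero.2 (hne z hz)), h1]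
  have hμr : |μ| ≠ r := by
    intro h
    refine hne (μ : ℂ) ?_ rfl
    simpa using h
  refine ⟨hμr, ?_⟩
  have hcont : ContinuousOn (resolvent (map T)) (sphere (0 : ℂ) r) := fun z hz =>
    (spectrum.hasDerivAt_resolvent_const_left (hT hz)).continuousAt.continuousWithinAt
  have hint : (∮ z in C(0, r), resolvent (map T) z) w = ∮ z in C(0, r), (z - (μ : ℂ))⁻¹ • w := by
    rw [circleIntegral, ContinuousLinearMap.intervalIntegral_apply
      (φ := fun θ => deriv (circleMap 0 r) θ • resolvent (map T) (circleMap 0 r θ))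
      (hcont.circleIntegrable hr).out, circleIntegral]
    refine intervalIntegral.integral_congr fun θ _ => ?_
    simp only [smul_apply]
    rw [hres _ (circleMap_mem_sphere 0 hr θ)]
  have hval : (∮ z in C(0, r), (z - (μ : ℂ))⁻¹) = if |μ| < r then 2 * Real.pi * Complex.I else 0 := by
    split_ifs with h
    · exact circleIntegral.integral_sub_inv_of_mem_ball (by simpa using h)
    · have h' : r < |μ| := lt_of_le_of_ne (not_lt.1 h) (Ne.symm hμr)
      have hz : ∀ z ∈ closedBall (0 : ℂ) r, z - μ ≠ 0 := by
        intro z hz h0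
        rw [sub_eq_zero] at h0
        subst h0
        have : |μ| ≤ r := by simpa using hz
        linarith
      refine Complex.circleIntegral_eq_zero_of_differentiable_on_off_countable hr
        Set.countable_empty ?_ ?_
      · exact ContinuousOn.inv₀ (by fun_prop) hz
      · intro z hz'
        have := hz z (ball_subset_closedBall hz'.1)
        fun_prop (disch := assumption)
  change (contourOperator T r w).re = _
  rw [contourOperator, smul_apply, hint, circleIntegral.integral_smul_const, hval, smul_smul]
  split_ifs with h
  · rw [inv_mul_cancel₀ Complex.two_pi_I_ne_zero, one_smul]
    rfl
  · simp

end Riesz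

/-! ### Spectral gaps and the Davis–Kahan estimate. -/

section Perturbation

variable {𝕜 : Type*} [RCLike 𝕜] {E : Type*} [NormedAddCommGroup E] [InnerProductSpace 𝕜 E]
  [CompleteSpace E] {T T' P P' : E →L[𝕜] E} {τ τ' a b δ : ℝ}

omit [CompleteSpace E] in
-- The lower end is clamped at 0 because the Davis–Kahan estimate needs a nonnegative one.
theorem eigenvalueGap_of_le_norm_sub_smul (h : ∀ x, δ * ‖x‖ ≤ ‖T x - (τ : 𝕜) • x‖) :
    EigenvalueGap T (max (τ - δ) 0) (τ + δ) := by
  intro μ x hμ hx hTx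
  have h1 := h x
  rw [hTx, ← sub_smul, ← RCLike.ofReal_sub, norm_smul, RCLike.norm_ofReal] at h1
  have h2 : δ ≤ |μ - τ| := le_of_mul_le_mul_right h1 (norm_pos_iff.2 hx)
  rcases le_abs.1 h2 with h3 | h3
  · right; linarith
  · left; exact le_max_of_le_left (by linarith)

omit [CompleteSpace E] in
-- A lower bound for `T - τ` is the form of a spectral gap that passes to nearby operators, by the
-- triangle inequality.
theorem le_norm_sub_smul_of_norm_sub_le (h : ∀ x, 2 * δ * ‖x‖ ≤ ‖T x - (τ : 𝕜) • x‖)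
    (hTT' : ‖T' - T‖ ≤ δ) (x : E) : δ * ‖x‖ ≤ ‖T' x - (τ : 𝕜) • x‖ := by
  have h1 := h x
  have h2 : ‖T' x - T x‖ ≤ δ * ‖x‖ := (T' - T).le_of_opNorm_le hTT' x
  have h3 : T x - (τ : 𝕜) • x = (T' x - (τ : 𝕜) • x) - (T' x - T x) := by abel
  have h4 := norm_sub_le (T' x - (τ : 𝕜) • x) (T' x - T x)
  rw [← h3] at h4
  linarith

/-- A Davis–Kahan estimate: the range of an upper spectral projector of `T'` is almost contained in
the range of an upper spectral projector of `T`, if both operators have a common spectral gap. -/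
theorem IsUpperSpectralProjector.mul_norm_sub_apply_le (hT : IsCompactOperator T)
    (hs : T.IsPositive) (hP : IsUpperSpectralProjector T P τ) (hgap : EigenvalueGap T a b)
    (hT' : IsCompactOperator T') (hs' : T'.IsPositive) (hP' : IsUpperSpectralProjector T' P' τ')
    (hgap' : EigenvalueGap T' a b) (ha : 0 ≤ a) (hab : a < b) (hτb : τ ≤ b) (haτ' : a ≤ τ')
    {v : E} (hv : v ∈ range P') : (b - a) * ‖v - P v‖ ≤ ‖T - T'‖ * ‖v‖ := by
  have hb : 0 < b := by linarith
  set X : E →L[𝕜] E := P' * (1 - P) with hX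
  -- For q = (1 - P) x one has T' P' q = X (T q) - P' (T - T') q. The left side is at least b ‖P' q‖
  -- and ‖T q‖ ≤ a ‖q‖; as a < b, the term a ‖X‖ can be absorbed later.
  have hXle : b * ‖X‖ ≤ ‖X‖ * a + ‖T - T'‖ := by
    rw [← le_div_iff₀' hb]
    refine X.opNorm_le_bound (by positivity) fun x => ?_
    rw [div_mul_eq_mul_div, le_div_iff₀' hb]
    set q := x - P x with hq
    have hXx : X x = P' q := by simp [hX, hq]
    have hPq : P q = 0 := by
      rw [hq, map_sub, sub_eq_zero]
      exact (congrArg (fun Q => Q x) (hP.mul_self hT hs)).symm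
    have hqx : ‖q‖ ≤ ‖x‖ := hP.norm_sub_apply_le hT hs x
    have hPTq : P (T q) = 0 := by
      have := congrArg (fun Q => Q q) (hP.commute hT hs).eq
      simpa [hPq] using this
    have h1 : b * ‖P' q‖ ≤ ‖T' (P' q)‖ := hP'.le_norm_apply hT' hs' hgap' hb.le haτ' q
    have h2 : T' (P' q) = X (T q) - P' ((T - T') q) := by
      have := congrArg (fun Q => Q q) (hP'.commute hT' hs').eq
      simp only [mul_apply_eq_comp] at this
      rw [← this]
      simp [hX, hPTq]
    have h3 : ‖X (T q)‖ ≤ ‖X‖ * (a * ‖x‖) := by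
      refine (X.le_opNorm _).trans ?_
      have : ‖T q‖ ≤ a * ‖q‖ := hP.norm_apply_sub_le hT hs hgap ha hτb x
      gcongr
      exact this.trans (by gcongr)
    have h4 : ‖P' ((T - T') q)‖ ≤ ‖T - T'‖ * ‖x‖ :=
      (hP'.norm_apply_le hT' hs' _).trans (((T - T').le_opNorm q).trans (by gcongr))
    rw [hXx]
    calc b * ‖P' q‖ ≤ ‖X (T q) - P' ((T - T') q)‖ := h2 ▸ h1
      _ ≤ ‖X‖ * (a * ‖x‖) + ‖T - T'‖ * ‖x‖ := (norm_sub_le _ _).trans (add_le_add h3 h4)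
      _ = _ := by ring
  -- The wanted operator (1 - P) P' is the adjoint of `X`, hence has the same norm.
  have hadj : star X = (1 - P) * P' := by
    rw [hX, star_mul, star_sub, star_one, (hP.isSelfAdjoint hT hs).star_eq,
      (hP'.isSelfAdjoint hT' hs').star_eq]
  have h5 : ‖v - P v‖ ≤ ‖X‖ * ‖v‖ := by
    have h6 : v - P v = (star X) v := by
      rw [hadj]
      simp [hP'.apply_of_mem_range hT' hs' hv]
    rw [h6, ← norm_star X]
    exact (star X).le_opNorm v
  calc (b - a) * ‖v - P v‖ ≤ (b - a) * (‖X‖ * ‖v‖) := by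
        have : 0 ≤ b - a := by linarith
        gcongr
    _ = (b * ‖X‖ - ‖X‖ * a) * ‖v‖ := by ring
    _ ≤ _ := by gcongr; linarith

end Perturbation

/-! ### The contour definition yields the upper spectral projector. -/

section Gram

variable {𝕜 : Type*} [RCLike 𝕜] {E : Type*} [NormedAddCommGroup E] [InnerProductSpace 𝕜 E]
  [CompleteSpace E] {F : Type*} [NormedAddCommGroup F] [InnerProductSpace 𝕜 F] [CompleteSpace F]
  {X : Type*} {A : X → E →L[𝕜] F} {B : Set X} {N : ℕ} {c m : X}

theorem isPositive_gram (A : X → E →L[𝕜] F) (m : X) : (gram A m).IsPositive :=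
  ContinuousLinearMap.isPositive_adjoint_comp_self (A m)

theorem isCompactOperator_gram (h : IsCompactOperator (A m)) : IsCompactOperator (gram A m) :=
  h.clm_comp (A m).adjoint

/-- Every eigenvalue lies inside the outer circle, so the outer integral fixes each eigenvector; the
inner integral subtracts those with eigenvalue below τ. -/
theorem isUpperSpectralProjector_spectralProjector (hm : ‖gram A m‖ < outerRadius A B)
    (hτ : 0 ≤ innerRadius A N c)
    (h : sphere (0 : ℂ) (innerRadius A N c) ⊆
      resolventSet ℂ (Complexification.map (gram A m))) :
    IsUpperSpectralProjector (gram A m) (spectralProjector A B N c m) (innerRadius A N c) := by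
  set T := gram A m
  have hs : T.IsPositive := isPositive_gram A m
  have hR0 : 0 ≤ outerRadius A B := (norm_nonneg _).trans hm.le
  have hR : sphere (0 : ℂ) (outerRadius A B) ⊆ resolventSet ℂ (Complexification.map T) := by
    refine sphere_subset_resolventSet hs (sub_pos.2 hm) fun x => ?_
    have h1 := norm_sub_norm_le ((outerRadius A B : 𝕜) • x) (T x)
    rw [norm_smul, RCLike.norm_ofReal, abs_of_nonneg hR0, norm_sub_rev] at h1
    have h2 := T.le_opNorm x
    linarith
  have hlt : ∀ (μ : ℝ) (x : E), x ≠ 0 → T x = (μ : 𝕜) • x → |μ| < outerRadius A B := by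
    intro μ x hx0 hx
    refine lt_of_le_of_lt ?_ hm
    have h1 := T.le_opNorm x
    rw [hx, norm_smul, RCLike.norm_ofReal] at h1
    exact le_of_mul_le_mul_right h1 (norm_pos_iff.2 hx0)
  refine ⟨fun μ x hμ hx => ?_, fun μ x hμ0 hμ hx => ?_, fun μ x hx0 hx h1 => ?_⟩
  · by_cases hx0 : x = 0
    · simp [hx0]
    · have h1 := (rieszIntegral_apply_of_eigenvector hR0 hR hx0 hx).2
      have h2 := (rieszIntegral_apply_of_eigenvector hτ h hx0 hx).2
      rw [if_pos (hlt μ x hx0 hx)] at h1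
      rw [if_neg (not_lt.2 (hμ.le.trans (le_abs_self μ)))] at h2
      simp [spectralProjector, T, h1, h2]
  · by_cases hx0 : x = 0
    · simp [hx0]
    · have h1 := (rieszIntegral_apply_of_eigenvector hR0 hR hx0 hx).2
      have h2 := (rieszIntegral_apply_of_eigenvector hτ h hx0 hx).2
      rw [if_pos (hlt μ x hx0 hx)] at h1
      rw [if_pos (by rwa [abs_of_nonneg hμ0])] at h2
      simp [spectralProjector, T, h1, h2]
  · have h2 := (rieszIntegral_apply_of_eigenvector hτ h hx0 hx).1
    rw [h1, abs_of_nonneg hτ] at h2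
    exact h2 rfl

end Gram

/-! ### Ranking the elements of a set of reals that accumulates at most at 0. -/

section RankedSup

theorem exists_lt_forall_le_of_finite {e : Set ℝ} {τ : ℝ} (hτ : 0 < τ)
    (hfin : {ν | ν ∈ e ∧ τ / 2 ≤ ν}.Finite) :
    ∃ t < τ, ∀ ν ∈ e, ν < τ → ν ≤ t := by
  have hF : (insert (τ / 2) ({ν | ν ∈ e ∧ τ / 2 ≤ ν} ∩ Iio τ)).Finite :=
    (hfin.inter_of_left _).insert _
  obtain ⟨t, ht, hmax⟩ := Set.exists_max_image _ id hF (insert_nonempty _ _)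
  refine ⟨t, ?_, fun ν hν hντ => ?_⟩
  · rcases ht with rfl | ht
    · linarith
    · exact ht.2
  · rcases le_total (τ / 2) ν with h | h
    · exact hmax ν (Or.inr ⟨⟨hν, h⟩, hντ⟩)
    · exact h.trans (hmax _ (mem_insert _ _))

/-- The supremum of the elements of `e` having at least `k` elements of `e` above them. -/
noncomputable def rankedSup (e : Set ℝ) (k : ℕ) : ℝ :=
  sSup {μ | μ ∈ e ∧ (k : ℕ∞) ≤ {ν | ν ∈ e ∧ μ ≤ ν}.encard}

variable {e : Set ℝ} {k N : ℕ}

theorem rankedSup_nonneg (h0 : ∀ ν ∈ e, 0 ≤ ν) : 0 ≤ rankedSup e k :=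
  Real.sSup_nonneg fun _ hμ => h0 _ hμ.1

theorem le_rankedSup (hb : BddAbove e) {μ : ℝ} (hμ : μ ∈ e)
    (hk : (k : ℕ∞) ≤ {ν | ν ∈ e ∧ μ ≤ ν}.encard) : μ ≤ rankedSup e k :=
  le_csSup (hb.mono fun _ h => h.1) ⟨hμ, hk⟩

/-- If τ belonged to `e`, count the elements that are at least τ. With `N + 1` or more, the (N+1)-st
is at least τ and the N-th exceeds it; with fewer, the N-th is at most τ and the (N+1)-st is
strictly below. Neither pair has average τ. Finiteness away from 0 makes the inequalities strict. -/
theorem rankedSup_midpoint_notMem (hb : BddAbove e)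
    (hfin : ∀ ε > 0, {ν | ν ∈ e ∧ ε ≤ ν}.Finite) (hN : 1 ≤ N)
    (hτ : 0 < (rankedSup e N + rankedSup e (N + 1)) / 2) :
    (rankedSup e N + rankedSup e (N + 1)) / 2 ∉ e := by
  set τ := (rankedSup e N + rankedSup e (N + 1)) / 2 with hτdef
  intro hmem
  have hmono : ∀ {μ ν : ℝ}, μ ≤ ν →
      {κ | κ ∈ e ∧ ν ≤ κ}.encard ≤ {κ | κ ∈ e ∧ μ ≤ κ}.encard := fun h =>
    encard_le_encard fun κ hκ => ⟨hκ.1, h.trans hκ.2⟩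
  have hstrict : ∀ {μ ν : ℝ}, 0 < μ → μ ∈ e → μ < ν → (N : ℕ∞) ≤ {κ | κ ∈ e ∧ ν ≤ κ}.encard →
      ((N + 1 : ℕ) : ℕ∞) ≤ {κ | κ ∈ e ∧ μ ≤ κ}.encard := by
    intro μ ν hμ0 hμ hμν h
    have h1 : insert μ {κ | κ ∈ e ∧ ν ≤ κ} ⊆ {κ | κ ∈ e ∧ μ ≤ κ} := by
      rintro κ (rfl | hκ)
      · exact ⟨hμ, le_rfl⟩
      · exact ⟨hκ.1, hμν.le.trans hκ.2⟩
    refine le_trans ?_ (encard_le_encard h1)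
    rw [encard_insert_of_notMem fun h => absurd h.2 (not_le.2 hμν)]
    push_cast
    gcongr
  by_cases hcount : ((N + 1 : ℕ) : ℕ∞) ≤ {κ | κ ∈ e ∧ τ ≤ κ}.encard
  · have h1 : τ ≤ rankedSup e (N + 1) := le_rankedSup hb hmem hcount
    have hfin' : ({κ | κ ∈ e ∧ τ ≤ κ} \ {τ}).Finite := (hfin τ hτ).sdiff
    have hcard : (N : ℕ∞) ≤ ({κ | κ ∈ e ∧ τ ≤ κ} \ {τ}).encard := by
      have := encard_sdiff_singleton_add_one (show τ ∈ {κ | κ ∈ e ∧ τ ≤ κ} from ⟨hmem, le_rfl⟩)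
      rw [← this] at hcount
      push_cast at hcount
      exact (ENat.add_le_add_iff_right ENat.one_ne_top).1 hcount
    have hne : ({κ | κ ∈ e ∧ τ ≤ κ} \ {τ}).Nonempty := by
      rw [← encard_pos]
      exact lt_of_lt_of_le (by exact_mod_cast hN) hcard
    obtain ⟨μ, hμ, hmin⟩ := Set.exists_min_image _ id hfin' hne
    have hμτ : τ < μ := lt_of_le_of_ne hμ.1.2 (Ne.symm hμ.2)
    have h2 : μ ≤ rankedSup e N := by
      refine le_rankedSup hb hμ.1.1 (hcard.trans (encard_le_encard fun κ hκ => ?_))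
      exact ⟨hκ.1.1, hmin κ hκ⟩
    linarith
  · have h1 : rankedSup e N ≤ τ := by
      refine Real.sSup_le (fun μ hμ => ?_) hτ.le
      by_contra! h
      exact hcount (hstrict hτ hmem h hμ.2)
    obtain ⟨t, htτ, ht⟩ := exists_lt_forall_le_of_finite hτ (hfin (τ / 2) (by positivity))
    have h2 : rankedSup e (N + 1) ≤ max t 0 := by
      refine Real.sSup_le (fun μ hμ => le_max_of_le_left (ht μ hμ.1 ?_)) (le_max_right _ _)
      by_contra! h
      exact hcount (hμ.2.trans (hmono h))
    have h3 : max t 0 < τ := max_lt htτ hτ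
    linarith

/-- In an infinite `e`, the least of any `N` elements would be a positive lower bound for `rankedSup
e N`. This serves the case of inner radius 0. -/
theorem finite_of_rankedSup_eq_zero (hb : BddAbove e) (h0 : ∀ ν ∈ e, 0 < ν) (hN : 1 ≤ N)
    (h : rankedSup e N = 0) : e.Finite := by
  by_contra hinf
  obtain ⟨t, hte, htN⟩ := Set.exists_subset_encard_eq (s := e) (k := (N : ℕ∞))
    (by rw [Set.Infinite.encard_eq hinf]; exact le_top)
  have htfin : t.Finite := finite_of_encard_eq_coe htN
  have hne : t.Nonempty := by
    rw [← encard_pos, htN]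
    exact_mod_cast hN
  obtain ⟨μ, hμ, hmin⟩ := Set.exists_min_image _ id htfin hne
  have h1 : μ ≤ rankedSup e N := le_rankedSup hb (hte hμ)
    (htN ▸ encard_le_encard fun κ hκ => ⟨hte hκ, hmin κ hκ⟩)
  have := h0 μ (hte hμ)
  linarith

end RankedSup

/-! ### Discreteness of the eigenvalues. -/

section Eigenvalues

open Module.End Filter

variable {𝕜 : Type*} [RCLike 𝕜] {E : Type*} [NormedAddCommGroup E] [InnerProductSpace 𝕜 E]
  [CompleteSpace E] {T : E →L[𝕜] E}

/-- The real eigenvalues of `T`. -/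
def realEigenvalues (T : E →L[𝕜] E) : Set ℝ :=
  {μ | HasEigenvalue (T : E →ₗ[𝕜] E) (μ : 𝕜)}

omit [CompleteSpace E] in
theorem distinctEigenvalue_eq_rankedSup (T : E →L[𝕜] E) (k : ℕ) :
    distinctEigenvalue T k = rankedSup (realEigenvalues T) k := rfl

omit [CompleteSpace E] in
theorem exists_norm_eq_one_of_mem_realEigenvalues {μ : ℝ} (h : μ ∈ realEigenvalues T) :
    ∃ x, ‖x‖ = 1 ∧ T x = (μ : 𝕜) • x := by
  obtain ⟨x, hx, hx0⟩ := HasEigenvalue.exists_hasEigenvector h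
  refine ⟨((‖x‖⁻¹ : ℝ) : 𝕜) • x, ?_, ?_⟩
  · rw [norm_smul, RCLike.norm_ofReal, abs_of_nonneg (by positivity),
      inv_mul_cancel₀ (norm_ne_zero_iff.2 hx0)]
  · rw [_root_.map_smul, show T x = (μ : 𝕜) • x from mem_eigenspace_iff.1 hx, smul_comm]

omit [CompleteSpace E] in
theorem mem_realEigenvalues {μ : ℝ} {x : E} (hx : x ≠ 0) (h : T x = (μ : 𝕜) • x) :
    μ ∈ realEigenvalues T :=
  hasEigenvalue_of_hasEigenvector ⟨mem_eigenspace_iff.2 h, hx⟩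

omit [CompleteSpace E] in
theorem nonneg_of_mem_realEigenvalues (hs : T.IsPositive) {μ : ℝ} (h : μ ∈ realEigenvalues T) :
    0 ≤ μ := by
  obtain ⟨x, hx, hTx⟩ := exists_norm_eq_one_of_mem_realEigenvalues h
  obtain ⟨ν, hν, h1⟩ := exists_eigenvalue_eq_ofReal hs (norm_ne_zero_iff.1 (by simp [hx])) hTx
  rwa [RCLike.ofReal_inj.1 h1]

omit [CompleteSpace E] in
theorem bddAbove_realEigenvalues (T : E →L[𝕜] E) : BddAbove (realEigenvalues T) := by
  refine ⟨‖T‖, fun μ hμ => ?_⟩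
  obtain ⟨x, hx, hTx⟩ := exists_norm_eq_one_of_mem_realEigenvalues hμ
  have h := T.le_opNorm x
  rw [hTx, norm_smul, hx, RCLike.norm_ofReal, mul_one, mul_one] at h
  exact (le_abs_self μ).trans h

omit [CompleteSpace E] in
/-- The eigenvalues of a compact positive operator accumulate at most at zero. -/
theorem finite_realEigenvalues_ge (hT : IsCompactOperator T) (hs : T.IsPositive) {ε : ℝ}
    (hε : 0 < ε) : {ν | ν ∈ realEigenvalues T ∧ ε ≤ ν}.Finite := by
  by_contra hinf
  set f := Set.Infinite.natEmbedding _ hinf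
  choose x hx hTx using fun n => exists_norm_eq_one_of_mem_realEigenvalues (f n).2.1
  -- Orthonormal eigenvectors with eigenvalues at least ε have ε-separated images, which compactness
  -- forbids.
  have hsep : ∀ i j, i ≠ j → ε ^ 2 ≤ ‖T (x i) - T (x j)‖ ^ 2 := by
    intro i j hij
    have horth : inner 𝕜 (x i) (x j) = 0 :=
      hs.isSymmetric.orthogonalFamily_eigenspaces (i := ((f i : ℝ) : 𝕜)) (j := ((f j : ℝ) : 𝕜))
        (fun h => hij (f.injective (Subtype.ext (RCLike.ofReal_inj.1 h))))
        ⟨x i, mem_eigenspace_iff.2 (hTx i)⟩ ⟨x j, mem_eigenspace_iff.2 (hTx j)⟩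
    have h1 := (f i).2.2
    rw [hTx, hTx, @norm_sub_sq 𝕜, inner_smul_left, inner_smul_right, horth, norm_smul, norm_smul,
      hx, hx, RCLike.norm_ofReal, RCLike.norm_ofReal]
    simp only [mul_zero, map_zero, sub_zero, mul_one, sq_abs]
    nlinarith [sq_nonneg (f j : ℝ)]
  obtain ⟨K, hK, hKx⟩ := hT.image_closedBall_subset_compact 1
  obtain ⟨y, -, φ, hφ, hlim⟩ := hK.tendsto_subseq (x := fun n => T (x n))
    fun n => hKx ⟨x n, by simp [hx], rfl⟩
  obtain ⟨M, hM⟩ := Metric.cauchySeq_iff'.1 hlim.cauchySeq ε hε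
  have h1 := hM (M + 1) (by omega)
  rw [dist_eq_norm] at h1
  have h2 := hsep (φ (M + 1)) (φ M) (hφ.injective.ne (by omega))
  have h3 := pow_lt_pow_left₀ h1 (norm_nonneg _) two_ne_zero
  exact absurd h2 (not_le.2 h3)

/-- If the eigenvalues of `T` do not accumulate at `τ ≥ 0`, then `T - τ` is bounded below. -/
theorem exists_le_norm_sub_smul_of_notMem (hT : IsCompactOperator T) (hs : T.IsPositive) {τ : ℝ}
    (hτ : 0 ≤ τ) (hfin : {ν | ν ∈ realEigenvalues T ∧ τ / 2 ≤ ν}.Finite)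
    (hmem : τ ∉ realEigenvalues T) : ∃ δ > 0, ∀ x, δ * ‖x‖ ≤ ‖T x - (τ : 𝕜) • x‖ := by
  have hopen : {ν | ν ∈ realEigenvalues T ∧ τ / 2 ≤ ν}ᶜ ∈ nhds τ :=
    hfin.isClosed.isOpen_compl.mem_nhds fun h => hmem h.1
  obtain ⟨δ, hδ, hball⟩ := Metric.mem_nhds_iff.1 hopen
  have hgap : ∀ ν ∈ realEigenvalues T, τ / 2 ≤ ν → δ ≤ |ν - τ| := by
    intro ν hν h
    by_contra! hlt
    exact hball (show ν ∈ ball τ δ from hlt) ⟨hν, h⟩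
  -- For τ = 0 every eigenvalue is at least τ / 2; for τ > 0 those below τ / 2 are at distance at
  -- least τ / 2 from τ.
  obtain ⟨δ', hδ', hgap'⟩ : ∃ δ' > 0, ∀ ν ∈ realEigenvalues T, δ' ≤ |ν - τ| := by
    rcases hτ.eq_or_lt with h | h
    · exact ⟨δ, hδ, fun ν hν => hgap ν hν (by
        have := nonneg_of_mem_realEigenvalues hs hν; linarith)⟩
    · refine ⟨min δ (τ / 2), lt_min hδ (by linarith), fun ν hν => ?_⟩
      rcases le_total (τ / 2) ν with h1 | h1
      · exact (min_le_left _ _).trans (hgap ν hν h1)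
      · refine (min_le_right _ _).trans (le_abs.2 (Or.inr ?_))
        linarith
  refine ⟨δ', hδ', le_norm_sub_smul_of_eigenvalueGap hT hs hδ'.le fun μ x _ hx h => ?_⟩
  rcases le_abs.1 (hgap' μ (mem_realEigenvalues hx h)) with h1 | h1
  · right; linarith
  · left; linarith

end Eigenvalues

/-! ### Existence of an admissible cover by balls. -/

section Cover

open Filter Topology

variable {𝕜 : Type*} [RCLike 𝕜] {E : Type*} [NormedAddCommGroup E] [InnerProductSpace 𝕜 E]
  [CompleteSpace E] {F : Type*} [NormedAddCommGroup F] [InnerProductSpace 𝕜 F] [CompleteSpace F]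

theorem innerRadius_nonneg {X : Type*} (A : X → E →L[𝕜] F) (N : ℕ) (c : X) :
    0 ≤ innerRadius A N c := by
  have h := fun k => rankedSup_nonneg (k := k) fun ν hν =>
    nonneg_of_mem_realEigenvalues (isPositive_gram A c) hν
  simp only [← distinctEigenvalue_eq_rankedSup] at h
  have h1 := h N
  have h2 := h (N + 1)
  unfold innerRadius
  linarith

/-- A positive midpoint is not an eigenvalue, by counting. If the midpoint is 0, the N-th eigenvalue
is 0 by convention; injectivity makes all eigenvalues positive, so they are finitely many and stay
away from 0. -/
theorem exists_le_norm_gram_sub_innerRadius {X : Type*} {A : X → E →L[𝕜] F} {N : ℕ} {c : X}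
    (hN : 1 ≤ N) (hc : IsCompactOperator (A c)) (hinj : Function.Injective (A c)) :
    ∃ δ > 0, ∀ x, δ * ‖x‖ ≤ ‖gram A c x - (innerRadius A N c : 𝕜) • x‖ := by
  have hs := isPositive_gram A c
  have hT := isCompactOperator_gram hc
  have hnn : ∀ ν ∈ realEigenvalues (gram A c), 0 ≤ ν := fun ν hν =>
    nonneg_of_mem_realEigenvalues hs hν
  have hb := bddAbove_realEigenvalues (gram A c)
  have hfin := fun ε (hε : 0 < ε) => finite_realEigenvalues_ge hT hs hε
  have hτ := innerRadius_nonneg A N c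
  have hdef : innerRadius A N c = (rankedSup (realEigenvalues (gram A c)) N +
    rankedSup (realEigenvalues (gram A c)) (N + 1)) / 2 := rfl
  rcases hτ.eq_or_lt with h | h
  · have h0 : (0 : ℝ) ∉ realEigenvalues (gram A c) := by
      intro h0
      obtain ⟨x, hx, hTx⟩ := exists_norm_eq_one_of_mem_realEigenvalues h0
      have h1 : inner 𝕜 (A c x) (A c x) = 0 := by
        rw [← ContinuousLinearMap.adjoint_inner_left]
        change inner 𝕜 (gram A c x) x = 0
        simp [hTx]
      have h2 : x = 0 := hinj (by rw [inner_self_eq_zero.1 h1, map_zero])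
      simp [h2] at hx
    have h1 := rankedSup_nonneg (k := N) hnn
    have h2 := rankedSup_nonneg (k := N + 1) hnn
    have hpos : ∀ ν ∈ realEigenvalues (gram A c), 0 < ν := fun ν hν =>
      lt_of_le_of_ne (hnn ν hν) fun h => h0 (h ▸ hν)
    have hF := finite_of_rankedSup_eq_zero hb hpos hN (by linarith)
    exact exists_le_norm_sub_smul_of_notMem hT hs hτ (hF.subset fun _ h => h.1) (h ▸ h0)
  · exact exists_le_norm_sub_smul_of_notMem hT hs hτ (hfin _ (by linarith))
      (rankedSup_midpoint_notMem hb hfin hN (hdef ▸ h))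

theorem continuousOn_gram {X : Type*} [TopologicalSpace X] {A : X → E →L[𝕜] F} {B : Set X}
    (hA : ContinuousOn A B) : ContinuousOn (gram A) B :=
  (ContinuousLinearMap.adjoint.continuous.comp_continuousOn hA).clm_comp hA

theorem norm_gram_lt_outerRadius {X : Type*} [TopologicalSpace X] {A : X → E →L[𝕜] F} {B : Set X}
    (hB : IsCompact B) (hA : ContinuousOn A B) {m : X} (hm : m ∈ B) :
    ‖gram A m‖ < outerRadius A B := by
  have h : ‖gram A m‖ ≤ sSup ((fun m => ‖gram A m‖) '' B) :=
    le_csSup (hB.bddAbove_image (continuousOn_gram hA).norm) (mem_image_of_mem _ hm)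
  unfold outerRadius
  linarith

theorem exists_isSpectralCover {X : Type*} [PseudoMetricSpace X] {A : X → E →L[𝕜] F} {B : Set X}
    (hB : IsCompact B) (hA : ContinuousOn A B) (hcompact : ∀ m ∈ B, IsCompactOperator (A m))
    (hinj : ∀ m ∈ B, Function.Injective (A m)) {N : ℕ} (hN : 1 ≤ N) :
    ∃ (n : ℕ) (c : Fin n → X) (r : Fin n → ℝ), (∀ i, 0 < r i) ∧
      IsSpectralCover A B N c (fun i => Metric.closedBall (c i) (r i)) := by
  have hloc : ∀ c ∈ B, ∃ r > 0, ∀ m ∈ B ∩ closedBall c r, sphere (0 : ℂ) (innerRadius A N c) ⊆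
      resolventSet ℂ (Complexification.map (gram A m)) := by
    intro c hc
    obtain ⟨δ, hδ, h⟩ := exists_le_norm_gram_sub_innerRadius hN (hcompact c hc) (hinj c hc)
    obtain ⟨r, hr, hball⟩ := Metric.continuousOn_iff.1 (continuousOn_gram hA) c hc (δ / 2)
      (by positivity)
    refine ⟨r / 2, by positivity, fun m hm => ?_⟩
    refine sphere_subset_resolventSet (isPositive_gram A m) (half_pos hδ)
      (le_norm_sub_smul_of_norm_sub_le (by simpa [mul_div_cancel₀] using h) ?_)
    rw [← dist_eq_norm]
    refine (hball m hm.1 (lt_of_le_of_lt (mem_closedBall.1 hm.2) (by linarith))).le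
  classical
  choose! r hr hsub using hloc
  obtain ⟨t, htB, ht⟩ := hB.elim_nhds_subcover (fun c => closedBall c (if c ∈ B then r c else 1))
    fun c hc => by
      simp only [hc, if_true]
      exact closedBall_mem_nhds c (hr c hc)
  have hmem : ∀ i, ((t.equivFin.symm i : t) : X) ∈ B := fun i => htB _ (t.equivFin.symm i).2
  refine ⟨t.card, fun i => t.equivFin.symm i, fun i => r (t.equivFin.symm i),
    fun i => hr _ (hmem i), hmem, fun i => isClosed_closedBall, fun m hm => ?_,
    fun i m hm => hsub _ (hmem i) m hm⟩
  obtain ⟨c, hc, hmc⟩ := mem_iUnion₂.1 (ht hm)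
  refine mem_iUnion.2 ⟨t.equivFin ⟨c, hc⟩, ?_⟩
  simp only [htB c hc, if_true] at hmc
  simpa using hmc

end Cover

/-! ### Compactness and limits along an ultrafilter. -/

section Limits

open Filter Topology

variable {𝕜 : Type*} [RCLike 𝕜] {E : Type*} [NormedAddCommGroup E] [InnerProductSpace 𝕜 E]
  [CompleteSpace E] {F : Type*} [NormedAddCommGroup F] [InnerProductSpace 𝕜 F] [CompleteSpace F]
  {α : Type*} {l : Ultrafilter α}

/-- The image of a ball of a Hilbert space under a bounded operator is closed. -/
theorem exists_apply_eq_of_tendsto (S : E →L[𝕜] F) {w : α → E} (hw : ∀ n, ‖w n‖ ≤ 1) {y : F}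
    (hy : Tendsto (fun n => S (w n)) l (𝓝 y)) : ∃ x, S x = y := by
  set φ : α → WeakDual 𝕜 E := fun n => StrongDual.toWeakDual (InnerProductSpace.toDual 𝕜 E (w n))
  have hmem : ∀ n, φ n ∈ WeakDual.toStrongDual ⁻¹' closedBall (0 : StrongDual 𝕜 E) 1 := by
    intro n
    simpa [φ] using hw n
  -- Banach–Alaoglu: ψ represents the weak limit of `w`, and testing against `S.adjoint f`
  -- identifies its image with `y`.
  obtain ⟨ψ, -, hψ⟩ := (WeakDual.isCompact_closedBall (𝕜 := 𝕜) (0 : StrongDual 𝕜 E) 1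
    ).ultrafilter_le_nhds (l.map φ) (by
      rw [Ultrafilter.coe_map, le_principal_iff, mem_map]
      exact Eventually.of_forall hmem)
  have hlim : Tendsto φ l (𝓝 ψ) := hψ
  refine ⟨(InnerProductSpace.toDual 𝕜 E).symm (WeakDual.toStrongDual ψ), ext_inner_right 𝕜
    fun f => ?_⟩
  rw [← ContinuousLinearMap.adjoint_inner_right, InnerProductSpace.toDual_symm_apply]
  have h1 : Tendsto (fun n => φ n (S.adjoint f)) l (𝓝 (ψ (S.adjoint f))) :=
    ((WeakDual.eval_continuous (S.adjoint f)).tendsto ψ).comp hlim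
  have h2 : Tendsto (fun n => φ n (S.adjoint f)) l (𝓝 (inner 𝕜 y f)) := by
    have h3 : ∀ n, φ n (S.adjoint f) = inner 𝕜 (S (w n)) f := fun n =>
      ContinuousLinearMap.adjoint_inner_right S (w n) f
    simp only [h3]
    exact hy.inner tendsto_const_nhds
  exact tendsto_nhds_unique h1 h2

/-- Bounded sequences in the ranges of upper spectral projectors of convergent operators are
relatively compact. -/
theorem exists_tendsto_of_mem_range {T P : α → E →L[𝕜] E} {T₀ P₀ : E →L[𝕜] E} {τ a b : ℝ}
    (hT : ∀ n, IsCompactOperator (T n)) (hs : ∀ n, (T n).IsPositive)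
    (hP : ∀ n, IsUpperSpectralProjector (T n) (P n) τ) (hT₀ : IsCompactOperator T₀)
    (hs₀ : T₀.IsPositive) (hP₀ : IsUpperSpectralProjector T₀ P₀ τ) (ha : 0 ≤ a) (hab : a < b)
    (haτ : a ≤ τ) (hτb : τ ≤ b) (hgap₀ : EigenvalueGap T₀ a b)
    (hgap : ∀ᶠ n in (l : Filter α), EigenvalueGap (T n) a b) (hlim : Tendsto T l (𝓝 T₀))
    {u : α → E} (hu : ∀ n, u n ∈ range (P n)) (hu1 : ∀ n, ‖u n‖ ≤ 1) :
    ∃ x, Tendsto u l (𝓝 x) := by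
  have hb : 0 < b := by linarith
  obtain ⟨K, hK, hKu⟩ := hT₀.image_closedBall_subset_compact 1
  obtain ⟨y, -, hy⟩ := hK.ultrafilter_le_nhds (l.map fun n => T₀ (u n)) (by
    rw [Ultrafilter.coe_map, le_principal_iff, mem_map]
    exact Eventually.of_forall fun n => hKu ⟨u n, by simpa using hu1 n, rfl⟩)
  have hy : Tendsto (fun n => T₀ (u n)) l (𝓝 y) := hy
  have hPy : Tendsto (fun n => T₀ (P₀ (u n))) l (𝓝 (P₀ y)) := by
    have h1 : ∀ n, T₀ (P₀ (u n)) = P₀ (T₀ (u n)) := fun n =>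
      (congrArg (fun Q => Q (u n)) (hP₀.commute hT₀ hs₀).eq).symm
    simp only [h1]
    exact (P₀.continuous.tendsto y).comp hy
  -- `T₀` is bounded below by `b` on the range of `P₀`, so convergence of `T₀ (P₀ (u n))` forces
  -- that of `P₀ (u n)`.
  have hcauchy : Cauchy (map (fun n => P₀ (u n)) (l : Filter α)) := by
    rw [cauchy_map_iff]
    refine ⟨l.neBot, tendsto_uniformity_iff_dist_tendsto_zero.2 ?_⟩
    have h1 := (cauchy_map_iff.1 hPy.cauchy_map).2
    have h2 := (tendsto_uniformity_iff_dist_tendsto_zero.1 h1).const_mul b⁻¹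
    rw [mul_zero] at h2
    refine squeeze_zero (fun _ => dist_nonneg) (fun p => ?_) h2
    rw [le_inv_mul_iff₀ hb, dist_eq_norm, dist_eq_norm, ← map_sub, ← map_sub, ← map_sub]
    exact hP₀.le_norm_apply hT₀ hs₀ hgap₀ hb.le haτ _
  obtain ⟨x, hx⟩ := CompleteSpace.complete hcauchy
  have hx : Tendsto (fun n => P₀ (u n)) l (𝓝 x) := hx
  refine ⟨x, ?_⟩
  have hdiff : Tendsto (fun n => u n - P₀ (u n)) l (𝓝 0) := by
    have h1 : Tendsto (fun n => (b - a)⁻¹ * ‖T₀ - T n‖) l (𝓝 0) := by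
      have := (((tendsto_const_nhds (x := T₀)).sub hlim).norm).const_mul (b - a)⁻¹
      simpa using this
    refine squeeze_zero_norm' ?_ h1
    filter_upwards [hgap] with n hn
    rw [le_inv_mul_iff₀ (by linarith)]
    have h2 := hP₀.mul_norm_sub_apply_le hT₀ hs₀ hgap₀ (hT n) (hs n) (hP n) hn ha hab hτb haτ (hu n)
    refine h2.trans (mul_le_of_le_one_right (norm_nonneg _) (hu1 n))
  simpa using hdiff.add hx

/-- Limits of difference quotients of a strictly differentiable family of operators. -/
theorem tendsto_smul_sub_of_hasStrictFDerivAt {X G : Type*} [NormedAddCommGroup X]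
    [NormedSpace ℝ X] [NormedAddCommGroup G] [NormedSpace ℝ G] {A : X → G} {A' : X →L[ℝ] G}
    {m₀ h : X} (hA : HasStrictFDerivAt A A' m₀) {m m' : α → X} {s : α → ℝ}
    (hm : Tendsto m l (𝓝 m₀)) (hm' : Tendsto m' l (𝓝 m₀))
    (hh : Tendsto (fun n => s n • (m n - m' n)) l (𝓝 h)) :
    Tendsto (fun n => s n • (A (m n) - A (m' n))) l (𝓝 (A' h)) := by
  have h1 := hA.isLittleO.comp_tendsto (hm.prodMk_nhds hm')
  have h2 : (fun n => s n • (A (m n) - A (m' n) - A' (m n - m' n))) =o[(l : Filter α)]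
      (fun n => s n • (m n - m' n)) :=
    (Asymptotics.isBigO_refl s _).smul_isLittleO h1
  have h3 : Tendsto (fun n => s n • (A (m n) - A (m' n) - A' (m n - m' n))) l (𝓝 0) :=
    (Asymptotics.isLittleO_one_iff ℝ).1 (h2.trans_isBigO (hh.isBigO_one ℝ))
  have h4 := h3.add ((A'.continuous.tendsto h).comp hh)
  rw [zero_add] at h4
  refine h4.congr fun n => ?_
  rw [Function.comp_apply, _root_.map_smul, ← smul_add, sub_add_cancel]

theorem norm_adjoint_comp_self_sub_le (S S' : E →L[𝕜] F) :
    ‖S.adjoint ∘L S - S'.adjoint ∘L S'‖ ≤ (‖S‖ + ‖S'‖) * ‖S - S'‖ := by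
  have h : S.adjoint ∘L S - S'.adjoint ∘L S' =
      S.adjoint ∘L (S - S') + (S - S').adjoint ∘L S' := by
    ext x
    simp [map_sub]
  rw [h]
  refine (norm_add_le _ _).trans ?_
  have h1 := S.adjoint.opNorm_comp_le (S - S')
  have h2 := (S - S').adjoint.opNorm_comp_le S'
  rw [LinearIsometryEquiv.norm_map] at h1 h2
  linarith

end Limits

/-! ### Persistence of the gap. -/

section Stability

open Filter Topology

variable {𝕜 : Type*} [RCLike 𝕜] {E : Type*} [NormedAddCommGroup E] [InnerProductSpace 𝕜 E]
  [CompleteSpace E] {F : Type*} [NormedAddCommGroup F] [InnerProductSpace 𝕜 F] [CompleteSpace F]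

/-- A spectral gap at one parameter persists at nearby parameters. -/
theorem exists_eventually_eigenvalueGap {X : Type*} [TopologicalSpace X] {A : X → E →L[𝕜] F}
    {B : Set X} (hA : ContinuousOn A B) {N : ℕ} {c m₀ : X} (hm₀ : m₀ ∈ B)
    (h : sphere (0 : ℂ) (innerRadius A N c) ⊆
      resolventSet ℂ (Complexification.map (gram A m₀))) :
    ∃ a b, 0 ≤ a ∧ a < b ∧ a ≤ innerRadius A N c ∧ innerRadius A N c ≤ b ∧
      ∀ᶠ m in 𝓝[B] m₀, EigenvalueGap (gram A m) a b := by
  have hτ := innerRadius_nonneg A N c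
  obtain ⟨δ, hδ, hle⟩ := exists_le_norm_sub_smul (𝕜 := 𝕜) (r := innerRadius A N c)
    (h (by simp [abs_of_nonneg hτ]))
  refine ⟨max (innerRadius A N c - δ / 2) 0, innerRadius A N c + δ / 2, le_max_right _ _,
    max_lt (by linarith) (by linarith), max_le (by linarith) hτ, by linarith, ?_⟩
  have h1 : ∀ᶠ m in 𝓝[B] m₀, gram A m ∈ closedBall (gram A m₀) (δ / 2) :=
    (continuousOn_gram hA m₀ hm₀) (closedBall_mem_nhds _ (by positivity))
  filter_upwards [h1] with m hm
  rw [mem_closedBall, dist_eq_norm] at hm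
  exact eigenvalueGap_of_le_norm_sub_smul
    (le_norm_sub_smul_of_norm_sub_le (by simpa [mul_div_cancel₀] using hle) hm)

end Stability

/-! ### The contradiction argument. -/

section LowerBound

open Filter Topology

variable {𝕜 : Type*} [RCLike 𝕜] {E : Type*} [NormedAddCommGroup E] [InnerProductSpace 𝕜 E]
  [CompleteSpace E] {F : Type*} [NormedAddCommGroup F] [InnerProductSpace 𝕜 F] [CompleteSpace F]

/-- If `T w` and the component of `w` below the spectral gap tend to zero, then so does `w`. -/
theorem tendsto_zero_of_tendsto_gram {α : Type*} {l : Filter α} {T P : α → E →L[𝕜] E} {τ a b : ℝ}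
    (hT : ∀ n, IsCompactOperator (T n)) (hs : ∀ n, (T n).IsPositive)
    (hP : ∀ n, IsUpperSpectralProjector (T n) (P n) τ) (hb : 0 < b) (haτ : a ≤ τ)
    (hgap : ∀ᶠ n in l, EigenvalueGap (T n) a b) {w : α → E}
    (hTw : Tendsto (fun n => T n (w n)) l (𝓝 0))
    (hQw : Tendsto (fun n => w n - P n (w n)) l (𝓝 0)) : Tendsto w l (𝓝 0) := by
  have h1 : Tendsto (fun n => P n (w n)) l (𝓝 0) := by
    have h2 : Tendsto (fun n => b⁻¹ * ‖T n (w n)‖) l (𝓝 0) := by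
      simpa using hTw.norm.const_mul b⁻¹
    refine squeeze_zero_norm' ?_ h2
    filter_upwards [hgap] with n hn
    rw [le_inv_mul_iff₀ hb]
    have h3 : T n (P n (w n)) = P n (T n (w n)) :=
      (congrArg (fun Q => Q (w n)) ((hP n).commute (hT n) (hs n)).eq).symm
    exact ((hP n).le_norm_apply (hT n) (hs n) hn hb.le haτ _).trans
      (h3 ▸ (hP n).norm_apply_le (hT n) (hs n) _)
  simpa using hQw.add h1

omit [CompleteSpace E] [CompleteSpace F] in
theorem tendsto_clm_apply {α : Type*} {l : Filter α} {S : α → E →L[𝕜] F} {S₀ : E →L[𝕜] F}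
    {x : α → E} {x₀ : E} (hS : Tendsto S l (𝓝 S₀)) (hx : Tendsto x l (𝓝 x₀)) :
    Tendsto (fun n => S n (x n)) l (𝓝 (S₀ x₀)) :=
  (isBoundedBilinearMap_apply (𝕜 := 𝕜) (E := E) (F := F)).continuous.tendsto (S₀, x₀) |>.comp
    (hS.prodMk_nhds hx)

variable [NormedSpace ℝ F] [IsScalarTower ℝ 𝕜 F]

/-- No sequence of normalised vectors violates the stability estimate asymptotically. -/
theorem false_of_ultrafilter_sequence {X : Type*} [NormedAddCommGroup X] [NormedSpace ℝ X]
    [FiniteDimensional ℝ X] {B : Set X} {A : X → E →L[𝕜] F} (hAc : ContinuousOn A B)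
    (hcompact : ∀ m ∈ B, IsCompactOperator (A m))
    (hdiff : ∀ m ∈ B, HasStrictFDerivAt A (fderiv ℝ A m) m)
    (hU1 : ∀ m ∈ B, ∀ m' ∈ B, ∀ u v : E, u ≠ 0 → A m u = A m' v → m = m' ∧ u = v)
    (hU2 : ∀ m ∈ B, ∀ q : X, ‖q‖ = 1 →
      Function.Injective (fun w : E × E => fderiv ℝ A m q w.1 + A m w.2))
    {α : Type*} {l : Ultrafilter α} {P P' : α → E →L[𝕜] E} {P₀ P₀' : E →L[𝕜] E}
    {τ τ' a b a' b' : ℝ} {m m' : α → X} {m₀ m₀' : X} {u v : α → E} {ε : α → ℝ}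
    (hmB : ∀ n, m n ∈ B) (hmB' : ∀ n, m' n ∈ B) (hm₀B : m₀ ∈ B) (hm₀B' : m₀' ∈ B)
    (hm : Tendsto m l (𝓝 m₀)) (hm' : Tendsto m' l (𝓝 m₀'))
    (hP : ∀ n, IsUpperSpectralProjector (gram A (m n)) (P n) τ)
    (hP' : ∀ n, IsUpperSpectralProjector (gram A (m' n)) (P' n) τ')
    (hP₀ : IsUpperSpectralProjector (gram A m₀) P₀ τ)
    (hP₀' : IsUpperSpectralProjector (gram A m₀') P₀' τ')
    (ha : 0 ≤ a) (hab : a < b) (haτ : a ≤ τ) (hτb : τ ≤ b)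
    (hgap : ∀ᶠ m in 𝓝[B] m₀, EigenvalueGap (gram A m) a b)
    (ha' : 0 ≤ a') (hab' : a' < b') (haτ' : a' ≤ τ') (hτb' : τ' ≤ b')
    (hgap' : ∀ᶠ m in 𝓝[B] m₀', EigenvalueGap (gram A m) a' b')
    (hττ' : τ ≤ τ') (hu : ∀ n, u n ∈ range (P n)) (hv : ∀ n, v n ∈ range (P' n))
    (huv : ∀ n, ‖u n‖ + ‖v n‖ = 1) (hε : Tendsto ε l (𝓝 0))
    (hlt : ∀ n, ‖A (m n) (u n) - A (m' n) (v n)‖ < ε n * (‖m n - m' n‖ + ‖u n - v n‖)) :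
    False := by
  have hTc : ∀ m ∈ B, IsCompactOperator (gram A m) := fun m hm =>
    isCompactOperator_gram (hcompact m hm)
  have hT : ∀ n, IsCompactOperator (gram A (m n)) := fun n => hTc _ (hmB n)
  have hT' : ∀ n, IsCompactOperator (gram A (m' n)) := fun n => hTc _ (hmB' n)
  have hs := isPositive_gram A
  have hw : Tendsto m l (𝓝[B] m₀) :=
    tendsto_nhdsWithin_iff.2 ⟨hm, Eventually.of_forall hmB⟩
  have hw' : Tendsto m' l (𝓝[B] m₀') :=
    tendsto_nhdsWithin_iff.2 ⟨hm', Eventually.of_forall hmB'⟩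
  have hAm : Tendsto (fun n => A (m n)) l (𝓝 (A m₀)) := (hAc m₀ hm₀B).tendsto.comp hw
  have hAm' : Tendsto (fun n => A (m' n)) l (𝓝 (A m₀')) := (hAc m₀' hm₀B').tendsto.comp hw'
  have hu1 : ∀ n, ‖u n‖ ≤ 1 := fun n => by have := huv n; have := norm_nonneg (v n); linarith
  have hv1 : ∀ n, ‖v n‖ ≤ 1 := fun n => by have := huv n; have := norm_nonneg (u n); linarith
  obtain ⟨u₀, hu₀⟩ := exists_tendsto_of_mem_range hT (fun n => hs _) hP (hTc _ hm₀B) (hs _) hP₀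
    ha hab haτ hτb (hgap.self_of_nhdsWithin hm₀B) (hw.eventually hgap)
    ((continuousOn_gram hAc m₀ hm₀B).tendsto.comp hw) hu hu1
  obtain ⟨v₀, hv₀⟩ := exists_tendsto_of_mem_range hT' (fun n => hs _) hP' (hTc _ hm₀B') (hs _) hP₀'
    ha' hab' haτ' hτb' (hgap'.self_of_nhdsWithin hm₀B') (hw'.eventually hgap')
    ((continuousOn_gram hAc m₀' hm₀B').tendsto.comp hw') hv hv1
  have huv₀ : ‖u₀‖ + ‖v₀‖ = 1 :=
    tendsto_nhds_unique (hu₀.norm.add hv₀.norm) (by simp only [huv]; exact tendsto_const_nhds)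
  have hdlim : Tendsto (fun n => ‖m n - m' n‖ + ‖u n - v n‖) l
      (𝓝 (‖m₀ - m₀'‖ + ‖u₀ - v₀‖)) := (hm.sub hm').norm.add (hu₀.sub hv₀).norm
  have hAuv : A m₀ u₀ = A m₀' v₀ := by
    have h1 : Tendsto (fun n => A (m n) (u n) - A (m' n) (v n)) l (𝓝 (A m₀ u₀ - A m₀' v₀)) :=
      (tendsto_clm_apply hAm hu₀).sub (tendsto_clm_apply hAm' hv₀)
    have h2 : Tendsto (fun n => A (m n) (u n) - A (m' n) (v n)) l (𝓝 0) :=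
      squeeze_zero_norm (fun n => (hlt n).le) (by simpa using hε.mul hdlim)
    exact sub_eq_zero.1 (tendsto_nhds_unique h1 h2)
  -- (U1) asks for a nonzero first vector; since ‖u₀‖ + ‖v₀‖ = 1, one of the two can play that role.
  obtain ⟨rfl, rfl⟩ : m₀ = m₀' ∧ u₀ = v₀ := by
    by_cases h : u₀ = 0
    · have hv0 : v₀ ≠ 0 := by
        rintro rfl
        simp [h] at huv₀
      obtain ⟨h1, h2⟩ := hU1 m₀' hm₀B' m₀ hm₀B v₀ u₀ hv0 hAuv.symm
      exact ⟨h1.symm, h2.symm⟩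
    · exact hU1 m₀ hm₀B m₀' hm₀B' u₀ v₀ h hAuv
  have hu₀0 : u₀ ≠ 0 := by
    rintro rfl
    simp at huv₀
  set d : α → ℝ := fun n => ‖m n - m' n‖ + ‖u n - v n‖ with hd
  have hd0 : ∀ n, 0 < d n := by
    intro n
    have h1 : 0 ≤ d n := by positivity
    refine lt_of_le_of_ne h1 fun h => ?_
    have h2 := hlt n
    change _ < ε n * d n at h2
    rw [← h, mul_zero] at h2
    exact absurd h2 (not_lt.2 (norm_nonneg _))
  set s : α → ℝ := fun n => (d n)⁻¹ with hsdef
  have hs0 : ∀ n, 0 < s n := fun n => inv_pos.2 (hd0 n)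
  have hsd : ∀ n, s n * d n = 1 := fun n => inv_mul_cancel₀ (hd0 n).ne'
  set w : α → E := fun n => (s n : 𝕜) • (u n - v n) with hwdef
  have hnw : ∀ n, ‖w n‖ = s n * ‖u n - v n‖ := fun n => by
    rw [hwdef, norm_smul, RCLike.norm_ofReal, abs_of_pos (hs0 n)]
  have hnh : ∀ n, ‖s n • (m n - m' n)‖ = s n * ‖m n - m' n‖ := fun n => by
    rw [norm_smul, Real.norm_of_nonneg (hs0 n).le]
  have hone : ∀ n, ‖s n • (m n - m' n)‖ + ‖w n‖ = 1 := fun n => by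
    rw [hnw, hnh, ← mul_add]
    exact hsd n
  have hw1 : ∀ n, ‖w n‖ ≤ 1 := fun n => by
    have := hone n
    have := norm_nonneg (s n • (m n - m' n))
    linarith
  obtain ⟨h, -, hh⟩ := (isCompact_closedBall (0 : X) 1).ultrafilter_le_nhds
    (l.map fun n => s n • (m n - m' n)) (by
      rw [Ultrafilter.coe_map, le_principal_iff, mem_map]
      refine Eventually.of_forall fun n => ?_
      have := hone n
      have := norm_nonneg (w n)
      simp only [mem_closedBall, dist_zero_right]
      linarith)
  have hh : Tendsto (fun n => s n • (m n - m' n)) l (𝓝 h) := hh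
  set A' := fderiv ℝ A m₀ with hA'
  have hG : Tendsto (fun n => s n • (A (m n) - A (m' n))) l (𝓝 (A' h)) :=
    tendsto_smul_sub_of_hasStrictFDerivAt (hdiff m₀ hm₀B) hm hm' hh
  -- A(m) w = s (A(m) u - A(m') v) - s (A(m) - A(m')) v. The first term is at most ε in norm, the
  -- second is a difference quotient applied to v → u₀.
  have hAw : Tendsto (fun n => A (m n) (w n)) l (𝓝 (-(A' h u₀))) := by
    have h1 : Tendsto (fun n => (s n : 𝕜) • (A (m n) (u n) - A (m' n) (v n))) l (𝓝 0) := by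
      refine squeeze_zero_norm (fun n => ?_) hε
      rw [norm_smul, RCLike.norm_ofReal, abs_of_pos (hs0 n)]
      calc s n * ‖A (m n) (u n) - A (m' n) (v n)‖ ≤ s n * (ε n * d n) :=
            mul_le_mul_of_nonneg_left (hlt n).le (hs0 n).le
        _ = ε n * (s n * d n) := by ring
        _ = ε n := by rw [hsd, mul_one]
    have h2 := h1.sub (tendsto_clm_apply hG hv₀)
    rw [zero_sub] at h2
    refine h2.congr fun n => ?_
    have h3 : (s n • (A (m n) - A (m' n))) (v n) = (s n : 𝕜) • (A (m n) (v n) - A (m' n) (v n)) :=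
      RCLike.real_smul_eq_coe_smul (K := 𝕜) _ _
    rw [h3, hwdef, ← smul_sub, _root_.map_smul, map_sub]
    congr 1
    abel
  have hh0 : h = 0 := by
    by_contra hne
    have h1 : Tendsto (fun n => A m₀ (w n)) l (𝓝 (-(A' h u₀))) := by
      have h2 : Tendsto (fun n => (A (m n) - A m₀) (w n)) l (𝓝 0) := by
        have h3 : Tendsto (fun n => ‖A (m n) - A m₀‖) l (𝓝 0) := by
          simpa using (hAm.sub (tendsto_const_nhds (x := A m₀))).norm
        refine squeeze_zero_norm (fun n => ?_) h3
        exact ((A (m n) - A m₀).le_opNorm _).trans (mul_le_of_le_one_right (norm_nonneg _) (hw1 n))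
      simpa using hAw.sub h2
    obtain ⟨x, hx⟩ := exists_apply_eq_of_tendsto (A m₀) hw1 h1
    have hnorm : ‖h‖ ≠ 0 := norm_ne_zero_iff.2 hne
    -- (U2) is stated for unit directions, so the length of `h` is moved onto `u₀`.
    have h4 : A' (‖h‖⁻¹ • h) ((‖h‖ : 𝕜) • u₀) = A' h u₀ := by
      rw [_root_.map_smul, _root_.map_smul, ← RCLike.real_smul_eq_coe_smul (K := 𝕜) (‖h‖)]
      change ‖h‖ • ‖h‖⁻¹ • (A' h u₀) = _
      rw [smul_smul, mul_inv_cancel₀ hnorm, one_smul]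
    have h5 := hU2 m₀ hm₀B (‖h‖⁻¹ • h) (by
      rw [norm_smul, norm_inv, norm_norm, inv_mul_cancel₀ hnorm])
      (a₁ := ((‖h‖ : 𝕜) • u₀, x)) (a₂ := (0, 0)) (by
        change A' (‖h‖⁻¹ • h) ((‖h‖ : 𝕜) • u₀) + A m₀ x = A' (‖h‖⁻¹ • h) 0 + A m₀ 0
        rw [h4, hx]
        simp)
    have h6 := (Prod.ext_iff.1 h5).1
    rcases smul_eq_zero.1 h6 with h7 | h7
    · exact hnorm (by exact_mod_cast h7)
    · exact hu₀0 h7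
  subst hh0
  simp only [map_zero, zero_apply, neg_zero] at hG hAw
  have hTw : Tendsto (fun n => gram A (m n) (w n)) l (𝓝 0) := by
    have h1 : Tendsto (fun n => (A (m n)).adjoint) l (𝓝 (A m₀).adjoint) :=
      (ContinuousLinearMap.adjoint.continuous.tendsto _).comp hAm
    have h2 := tendsto_clm_apply h1 hAw
    rwa [map_zero] at h2
  -- `P n` fixes `u n`, so only `v n` contributes. Davis–Kahan applies with the gap of τ because `τ
  -- ≤ τ'` makes the range of `P' n` almost contained in that of `P n`.
  have hQw : Tendsto (fun n => w n - P n (w n)) l (𝓝 0) := by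
    have h1 : Tendsto (fun n => (b - a)⁻¹ * ((‖A (m n)‖ + ‖A (m' n)‖) *
        ‖s n • (A (m n) - A (m' n))‖)) l (𝓝 0) := by
      simpa using ((hAm.norm.add hAm'.norm).mul hG.norm).const_mul (b - a)⁻¹
    refine squeeze_zero_norm' ?_ h1
    filter_upwards [hw.eventually hgap, hw'.eventually hgap] with n hn hn'
    rw [le_inv_mul_iff₀ (by linarith)]
    have h2 := (hP n).mul_norm_sub_apply_le (hT n) (hs _) hn (hT' n) (hs _) (hP' n) hn' ha hab hτb
      (haτ.trans hττ') (hv n)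
    have h3 : w n - P n (w n) = -((s n : 𝕜) • (v n - P n (v n))) := by
      rw [hwdef, _root_.map_smul, map_sub, (hP n).apply_of_mem_range (hT n) (hs _) (hu n)]
      module
    have h4 : ‖gram A (m n) - gram A (m' n)‖ ≤
        (‖A (m n)‖ + ‖A (m' n)‖) * ‖A (m n) - A (m' n)‖ := norm_adjoint_comp_self_sub_le _ _
    rw [h3, norm_neg, norm_smul, RCLike.norm_ofReal, abs_of_pos (hs0 n), norm_smul,
      Real.norm_of_nonneg (hs0 n).le]
    calc (b - a) * (s n * ‖v n - P n (v n)‖) = s n * ((b - a) * ‖v n - P n (v n)‖) := by ring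
      _ ≤ s n * ((‖A (m n)‖ + ‖A (m' n)‖) * ‖A (m n) - A (m' n)‖) :=
        mul_le_mul_of_nonneg_left
          ((h2.trans (mul_le_of_le_one_right (norm_nonneg _) (hv1 n))).trans h4) (hs0 n).le
      _ = _ := by ring
  have hwlim := tendsto_zero_of_tendsto_gram hT (fun n => hs _) hP (by linarith) haτ
    (hw.eventually hgap) hTw hQw
  have h1 := hh.norm.add hwlim.norm
  simp only [hone, norm_zero, add_zero] at h1
  exact one_ne_zero (tendsto_nhds_unique tendsto_const_nhds h1)

end LowerBound

/-! ### Normalisation, homogeneity and assembly. -/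

section MainTheorem

open Filter Topology

variable {𝕜 : Type*} [RCLike 𝕜] {E : Type*} [NormedAddCommGroup E] [InnerProductSpace 𝕜 E]
  [CompleteSpace E] {F : Type*} [NormedAddCommGroup F] [InnerProductSpace 𝕜 F] [CompleteSpace F]
  [NormedSpace ℝ F] [IsScalarTower ℝ 𝕜 F]

/-- The stability estimate for normalised vectors and two parameter regions. -/
theorem exists_normalized_lower_bound {X : Type*} [NormedAddCommGroup X] [NormedSpace ℝ X]
    [FiniteDimensional ℝ X] {B : Set X} (hB : IsCompact B) {A : X → E →L[𝕜] F}
    (hAc : ContinuousOn A B) (hcompact : ∀ m ∈ B, IsCompactOperator (A m))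
    (hdiff : ∀ m ∈ B, HasStrictFDerivAt A (fderiv ℝ A m) m)
    (hU1 : ∀ m ∈ B, ∀ m' ∈ B, ∀ u v : E, u ≠ 0 → A m u = A m' v → m = m' ∧ u = v)
    (hU2 : ∀ m ∈ B, ∀ q : X, ‖q‖ = 1 →
      Function.Injective (fun w : E × E => fderiv ℝ A m q w.1 + A m w.2))
    {N : ℕ} {c c' : X} {V V' : Set X} (hV : IsClosed V) (hV' : IsClosed V')
    (hcirc : ∀ m ∈ B ∩ V, sphere (0 : ℂ) (innerRadius A N c) ⊆
      resolventSet ℂ (Complexification.map (gram A m)))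
    (hcirc' : ∀ m ∈ B ∩ V', sphere (0 : ℂ) (innerRadius A N c') ⊆
      resolventSet ℂ (Complexification.map (gram A m)))
    (hcc' : innerRadius A N c ≤ innerRadius A N c') :
    ∃ C : ℝ, 0 < C ∧ ∀ m ∈ B ∩ V, ∀ m' ∈ B ∩ V', ∀ u ∈ range (spectralProjector A B N c m),
      ∀ v ∈ range (spectralProjector A B N c' m'), ‖u‖ + ‖v‖ = 1 →
      C * (‖m - m'‖ + ‖u - v‖) ≤ ‖A m u - A m' v‖ := by
  by_contra! hcon
  choose m hm m' hm' u hu v hv huv hlt using fun n : ℕ =>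
    hcon (1 / ((n : ℝ) + 1)) (by positivity)
  have hproj : ∀ m ∈ B ∩ V, IsUpperSpectralProjector (gram A m) (spectralProjector A B N c m)
      (innerRadius A N c) := fun m hm => isUpperSpectralProjector_spectralProjector
    (norm_gram_lt_outerRadius hB hAc hm.1) (innerRadius_nonneg A N c) (hcirc m hm)
  have hproj' : ∀ m ∈ B ∩ V', IsUpperSpectralProjector (gram A m) (spectralProjector A B N c' m)
      (innerRadius A N c') := fun m hm => isUpperSpectralProjector_spectralProjector
    (norm_gram_lt_outerRadius hB hAc hm.1) (innerRadius_nonneg A N c') (hcirc' m hm)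
  -- Along an ultrafilter every sequence in a compact set converges, which replaces the extraction
  -- of subsequences.
  set l : Ultrafilter ℕ := hyperfilter ℕ
  obtain ⟨m₀, hm₀, hlim⟩ := (hB.inter_right hV).ultrafilter_le_nhds (l.map m) (by
    rw [Ultrafilter.coe_map, le_principal_iff, mem_map]
    exact Eventually.of_forall hm)
  obtain ⟨m₀', hm₀', hlim'⟩ := (hB.inter_right hV').ultrafilter_le_nhds (l.map m') (by
    rw [Ultrafilter.coe_map, le_principal_iff, mem_map]
    exact Eventually.of_forall hm')
  obtain ⟨a, b, ha, hab, haτ, hτb, hgap⟩ :=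
    exists_eventually_eigenvalueGap hAc hm₀.1 (hcirc m₀ hm₀)
  obtain ⟨a', b', ha', hab', haτ', hτb', hgap'⟩ :=
    exists_eventually_eigenvalueGap hAc hm₀'.1 (hcirc' m₀' hm₀')
  exact false_of_ultrafilter_sequence hAc hcompact hdiff hU1 hU2 (l := l)
    (fun n => (hm n).1) (fun n => (hm' n).1) hm₀.1 hm₀'.1 hlim hlim' (fun n => hproj _ (hm n))
    (fun n => hproj' _ (hm' n)) (hproj _ hm₀) (hproj' _ hm₀') ha hab haτ hτb hgap ha' hab' haτ'
    hτb' hgap' hcc' hu hv huv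
    (tendsto_one_div_add_atTop_nhds_zero_nat.mono_left
      (Nat.hyperfilter_le_atTop)) hlt

omit [CompleteSpace E] [CompleteSpace F] [NormedSpace ℝ F] [IsScalarTower ℝ 𝕜 F] in
/-- A bound for normalised pairs extends to all pairs by homogeneity. -/
theorem homogeneous_lower_bound {S S' : E →L[𝕜] F} {P P' : E →L[𝕜] E} {C t : ℝ}
    (h : ∀ u ∈ range P, ∀ v ∈ range P', ‖u‖ + ‖v‖ = 1 → C * (t + ‖u - v‖) ≤ ‖S u - S' v‖)
    {u v : E} (hu : u ∈ range P) (hv : v ∈ range P') :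
    C * (t * (‖u‖ + ‖v‖) + ‖u - v‖) ≤ ‖S u - S' v‖ := by
  obtain ⟨x, rfl⟩ := hu
  obtain ⟨y, rfl⟩ := hv
  set k := ‖P x‖ + ‖P' y‖ with hk
  have hk0 : 0 ≤ k := by positivity
  rcases hk0.eq_or_lt with h0 | h0
  · have h1 : P x = 0 := norm_eq_zero.1 (by linarith [norm_nonneg (P x), norm_nonneg (P' y)])
    have h2 : P' y = 0 := norm_eq_zero.1 (by linarith [norm_nonneg (P x), norm_nonneg (P' y)])
    simp [← h0, h1, h2]
  · have h1 := h (((k⁻¹ : ℝ) : 𝕜) • P x) ⟨((k⁻¹ : ℝ) : 𝕜) • x, map_smul _ _ _⟩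
      (((k⁻¹ : ℝ) : 𝕜) • P' y) ⟨((k⁻¹ : ℝ) : 𝕜) • y, map_smul _ _ _⟩ (by
        rw [norm_smul, norm_smul, RCLike.norm_ofReal, abs_of_nonneg (by positivity), ← mul_add,
          inv_mul_cancel₀ h0.ne'])
    rw [map_smul, map_smul, ← smul_sub, ← smul_sub, norm_smul, norm_smul, RCLike.norm_ofReal,
      abs_of_nonneg (by positivity)] at h1
    have h2 := mul_le_mul_of_nonneg_left h1 hk0
    have e1 : k * (k⁻¹ * ‖S (P x) - S' (P' y)‖) = ‖S (P x) - S' (P' y)‖ := by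
      rw [← mul_assoc, mul_inv_cancel₀ h0.ne', one_mul]
    have e2 : k * (C * (t + k⁻¹ * ‖P x - P' y‖)) = C * (t * k + ‖P x - P' y‖) := by
      have := h0.ne'
      field_simp
    rwa [e1, e2] at h2

end MainTheorem

theorem mainTheorem2 {𝕜 : Type*} [RCLike 𝕜]
    {E : Type*} [NormedAddCommGroup E] [InnerProductSpace 𝕜 E] [CompleteSpace E]
    {F : Type*} [NormedAddCommGroup F] [InnerProductSpace 𝕜 F] [CompleteSpace F]
    [NormedSpace ℝ F] [IsScalarTower ℝ 𝕜 F]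
    {p : ℕ} (B U : Set (EuclideanSpace ℝ (Fin p)))
    (hB : IsCompact B) (hU : IsOpen U) (hBU : B ⊆ U)
    (A : EuclideanSpace ℝ (Fin p) → E →L[𝕜] F)
    (hcompact : ∀ m ∈ B, IsCompactOperator (A m))
    (hC1 : ContDiffOn ℝ 1 A U)
    (hU1 : ∀ m ∈ B, ∀ m' ∈ B, ∀ u v : E, u ≠ 0 → A m u = A m' v → m = m' ∧ u = v)
    (hU2 : ∀ m ∈ B, ∀ q : EuclideanSpace ℝ (Fin p), ‖q‖ = 1 →
      Function.Injective (fun w : E × E => fderiv ℝ A m q w.1 + A m w.2))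
    (N : ℕ) (hN : 1 ≤ N) :
    (∃ (n : ℕ) (c : Fin n → EuclideanSpace ℝ (Fin p)) (r : Fin n → ℝ), (∀ i, 0 < r i) ∧
      IsSpectralCover A B N c (fun i => Metric.closedBall (c i) (r i))) ∧
    ∀ (ι : Type) [Finite ι] (c : ι → EuclideanSpace ℝ (Fin p))
      (V : ι → Set (EuclideanSpace ℝ (Fin p))), IsSpectralCover A B N c V →
      ∃ C : ℝ, 0 < C ∧ ∀ i j : ι, ∀ m ∈ B ∩ V i, ∀ m' ∈ B ∩ V j,
        ∀ u ∈ Set.range (spectralProjector A B N (c i) m),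
        ∀ v ∈ Set.range (spectralProjector A B N (c j) m'),
          C * (‖m - m'‖ * ‖v‖ + ‖u - v‖) ≤ ‖A m u - A m' v‖ := by
  have hAc : ContinuousOn A B := hC1.continuousOn.mono hBU
  -- Strict differentiability is needed because both endpoints of the difference quotients move.
  have hdiff : ∀ m ∈ B, HasStrictFDerivAt A (fderiv ℝ A m) m := fun m hm =>
    (hC1.contDiffAt (hU.mem_nhds (hBU hm))).hasStrictFDerivAt one_ne_zero
  have hinj : ∀ m ∈ B, Function.Injective (A m) := fun m hm u v huv => by
    by_cases hu : u = 0
    · by_contra hne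
      exact hne (hU1 m hm m hm v u (fun hv => hne (hu.trans hv.symm)) huv.symm).2.symm
    · exact (hU1 m hm m hm u v hu huv).2
  refine ⟨exists_isSpectralCover hB hAc hcompact hinj hN, fun ι _ c V hcov => ?_⟩
  -- The weight ‖u‖ + ‖v‖ makes the bound symmetric under exchanging the two pairs, so the inner
  -- radii may be taken ordered.
  have hordered : ∀ i j : ι, innerRadius A N (c i) ≤ innerRadius A N (c j) → ∃ C : ℝ, 0 < C ∧
      ∀ m ∈ B ∩ V i, ∀ m' ∈ B ∩ V j, ∀ u ∈ range (spectralProjector A B N (c i) m),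
      ∀ v ∈ range (spectralProjector A B N (c j) m'),
      C * (‖m - m'‖ * (‖u‖ + ‖v‖) + ‖u - v‖) ≤ ‖A m u - A m' v‖ := by
    intro i j hij
    obtain ⟨C, hC, h⟩ := exists_normalized_lower_bound hB hAc hcompact hdiff hU1 hU2
      (hcov.isClosed i) (hcov.isClosed j) (hcov.circle_subset i) (hcov.circle_subset j) hij
    exact ⟨C, hC, fun m hm m' hm' u hu v hv => homogeneous_lower_bound (h m hm m' hm') hu hv⟩
  have hpair : ∀ k : ι × ι, ∃ C : ℝ, 0 < C ∧
      ∀ m ∈ B ∩ V k.1, ∀ m' ∈ B ∩ V k.2, ∀ u ∈ range (spectralProjector A B N (c k.1) m),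
      ∀ v ∈ range (spectralProjector A B N (c k.2) m'),
      C * (‖m - m'‖ * (‖u‖ + ‖v‖) + ‖u - v‖) ≤ ‖A m u - A m' v‖ := by
    rintro ⟨i, j⟩
    rcases le_total (innerRadius A N (c i)) (innerRadius A N (c j)) with hij | hij
    · exact hordered i j hij
    · obtain ⟨C, hC, h⟩ := hordered j i hij
      refine ⟨C, hC, fun m hm m' hm' u hu v hv => ?_⟩
      have h1 := h m' hm' m hm v hv u hu
      rwa [norm_sub_rev m' m, norm_sub_rev v u, norm_sub_rev (A m' v), add_comm ‖v‖] at h1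
  choose C hC h using hpair
  obtain ⟨C₀, hC₀, hle⟩ : ∃ C₀ : ℝ, 0 < C₀ ∧ ∀ k, C₀ ≤ C k := by
    rcases isEmpty_or_nonempty (ι × ι) with he | hne
    · exact ⟨1, one_pos, fun k => he.elim k⟩
    · obtain ⟨k, hk⟩ := Finite.exists_min C
      exact ⟨C k, hC k, hk⟩
  refine ⟨C₀, hC₀, fun i j m hm m' hm' u hu v hv => le_trans ?_ (h (i, j) m hm m' hm' u hu v hv)⟩
  have := norm_nonneg u
  exact mul_le_mul (hle _) (by gcongr; linarith) (by positivity) (hC _).le
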